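/- For $n\ge 0$ let $\mathcal S_n$ be the set of permutations of $\{1,\dots,n\}$, written as words. An \emph{occurrence} of $\tau\in\mathcal S_k$ in $\pi\in\mathcal S_n$ is a factor $\pi(d+1)\pi(d+2)\cdots\pi(d+k)$ of $\pi$ such that $\pi(d+1)-\tau(1)=\cdots=\pi(d+k)-\tau(k)$; $\pi$ \emph{avoids} $\tau$ if it has no occurrence of $\tau$. Let $\mathcal S_n(132,213,321,2341)$ be the set of $\pi\in\mathcal S_n$ that avoid each of $132$, $213$, $321$, $2341$. Let $\equiv$ be the equivalence relation on $\mathcal S_n$ induced by $123\equiv132\equiv213\equiv321$, that is, the smallest equivalence relation such that $\pi\equiv\pi'$ whenever $\pi'\in\mathcal S_n$ is obtained from $\pi$ by replacing an occurrence of one of the patterns $123,132,213,321$ by an occurrence, in the same positions, of another of them, leaving all other letters unchanged. Then, for every $n\ge0$, every equivalence class of $\equiv$ on $\mathcal S_n$ contains exactly one element of $\mathcal S_n(132,213,321,2341)$; in particular the number of classes is $|\mathcal S_n/{\equiv}|=|\mathcal S_n(132,213,321,2341)|$. Moreover, as formal power series in $\mathbb Q[[x]]$, $$\sum_{n\ge0}|\mathcal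 S_n/{\equiv}|\,x^n=\sum_{n\ge0}|\mathcal S_n(132,213,321,2341)|\,x^n=\sum_{m\ge0}m!\left(\frac{-x^5-2x^4-2x^3+x^2+x}{x^2+x+1}\right)^m .$$ -/

import Mathlib

open scoped Nat PowerSeries

namespace Hertzsprung

/-- The pattern `τ ∈ S_k` occurs in `π ∈ S_n` at the positions `d, d + 1, …, d + k - 1`
(counted from `0`): the letters of `π` there differ from those of `τ` by a constant integer. -/
def OccursAt {k n : ℕ} (τ : Equiv.Perm (Fin k)) (π : Equiv.Perm (Fin n)) (d : ℕ) : Prop :=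
  ∃ h : d + k ≤ n, ∃ c : ℤ, ∀ i : Fin k,
    ((τ i : ℕ) : ℤ) - ((π ⟨d + i, by have := i.isLt; omega⟩ : ℕ) : ℤ) = c

/-- `π` avoids the Hertzsprung pattern `τ`: no factor of `π` is an occurrence of `τ`. -/
def Avoids {k n : ℕ} (π : Equiv.Perm (Fin n)) (τ : Equiv.Perm (Fin k)) : Prop :=
  ∀ d : ℕ, ¬ OccursAt τ π d

/-- `π'` arises from `π` by replacing one occurrence of a pattern `α ∈ P` by an occurrence, at
the same positions, of a pattern `β ∈ P`, all other letters being unchanged. -/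
def Replace {k n : ℕ} (P : Set (Equiv.Perm (Fin k))) (π π' : Equiv.Perm (Fin n)) : Prop :=
  ∃ α ∈ P, ∃ β ∈ P, ∃ d : ℕ, OccursAt α π d ∧ OccursAt β π' d ∧
    ∀ j : Fin n, ((j : ℕ) < d ∨ d + k ≤ (j : ℕ)) → π j = π' j

/-- The equivalence relation on `S_n` induced by declaring all patterns in `P` equivalent. -/
def patternSetoid {k : ℕ} (P : Set (Equiv.Perm (Fin k))) (n : ℕ) :
    Setoid (Equiv.Perm (Fin n)) :=
  Relation.EqvGen.setoid (Replace P)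

/-- The permutation `123` (letters are `0, 1, 2` in the code). -/
def p123 : Equiv.Perm (Fin 3) := ⟨![0, 1, 2], ![0, 1, 2], by decide, by decide⟩

/-- The permutation `132`. -/
def p132 : Equiv.Perm (Fin 3) := ⟨![0, 2, 1], ![0, 2, 1], by decide, by decide⟩

/-- The permutation `213`. -/
def p213 : Equiv.Perm (Fin 3) := ⟨![1, 0, 2], ![1, 0, 2], by decide, by decide⟩

/-- The permutation `321`. -/
def p321 : Equiv.Perm (Fin 3) := ⟨![2, 1, 0], ![2, 1, 0], by decide, by decide⟩

/-- The permutation `2341`; its inverse is `4123`. -/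
def p2341 : Equiv.Perm (Fin 4) := ⟨![1, 2, 3, 0], ![3, 0, 1, 2], by decide, by decide⟩

/-- The equivalence relation on `S_n` induced by `123 ≡ 132 ≡ 213 ≡ 321`. -/
def eqvSetoid (n : ℕ) : Setoid (Equiv.Perm (Fin n)) :=
  patternSetoid {p123, p132, p213, p321} n

/-- The set `S_n(132, 213, 321, 2341)`. -/
def avoiders (n : ℕ) : Set (Equiv.Perm (Fin n)) :=
  {π | Avoids π p132 ∧ Avoids π p213 ∧ Avoids π p321 ∧ Avoids π p2341}

/-- The series `∑ f m` of formal power series converges formally to `F`: convergence is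
coefficientwise, the coefficients carrying the discrete topology. -/
def HasFormalSum (f : ℕ → ℚ⟦X⟧) (F : ℚ⟦X⟧) : Prop :=
  letI : TopologicalSpace ℚ := ⊥
  letI : TopologicalSpace ℚ⟦X⟧ := PowerSeries.WithPiTopology.instTopologicalSpace ℚ
  HasSum f F

/-- `(-x⁵ - 2x⁴ - 2x³ + x² + x) / (x² + x + 1)` as a formal power series; the denominator has
constant term `1`, so that `⁻¹` is a true inverse. -/
noncomputable def ratio : ℚ⟦X⟧ :=
  (-PowerSeries.X ^ 5 - 2 * PowerSeries.X ^ 4 - 2 * PowerSeries.X ^ 3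
      + PowerSeries.X ^ 2 + PowerSeries.X)
    * (PowerSeries.X ^ 2 + PowerSeries.X + 1)⁻¹

end Hertzsprung

namespace Hertzsprung

/-! ### Permutations as words -/

/-! The proof has two independent halves.

Classes. Orient the relation as rewriting rules 132, 213, 321 → 123. The word 4321 then reduces both
to 2341 and to 4123, so Knuth–Bendix completion adds the rule 2341 → 4123; this leaves the
equivalence unchanged because 2341 ≡ 4321 ≡ 4123. The enlarged system terminates
(`sum_lt_of_wordStep`) and all its overlaps can be joined (`rearrange_join_of_le`), so by Newman's
lemma each class contains exactly one irreducible permutation. Irreducible means avoiding the four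
left-hand sides.

Counting. This is the Goulden–Jackson cluster method. Inclusion–exclusion over sets of marked
occurrences cuts a word into blocks, each a single letter or a cluster of overlapping marked
patterns. Overlaps are so rigid (`overlap_cases`) that the first pattern and the length of a cluster
determine its letters up to translation, and these letters fill an interval. Hence `m` prescribed
blocks can be arranged in `m !` ways (`card_blocks`), and the avoiders are counted by the sum of `m
! * B ^ m`, where `B` is the signed generating function of blocks. Sets of occurrences never appear
explicitly: `free_eq_sum_blocks` strips one block from the left, and `sum_free_of_fits` iterates
this over all permutations at once. -/

/-- The word of a permutation, with letters and positions counted from `0`, continued by `0`. -/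
def word {n : ℕ} (π : Equiv.Perm (Fin n)) (i : ℕ) : ℤ :=
  if h : i < n then ((π ⟨i, h⟩ : ℕ) : ℤ) else 0

theorem word_of_lt {n : ℕ} (π : Equiv.Perm (Fin n)) {i : ℕ} (h : i < n) :
    word π i = ((π ⟨i, h⟩ : ℕ) : ℤ) := dif_pos h

theorem word_of_le {n : ℕ} (π : Equiv.Perm (Fin n)) {i : ℕ} (h : n ≤ i) : word π i = 0 :=
  dif_neg (by omega)

theorem word_inj {n : ℕ} (π : Equiv.Perm (Fin n)) {i j : ℕ} (hi : i < n) (hj : j < n)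
    (h : word π i = word π j) : i = j := by
  rw [word_of_lt π hi, word_of_lt π hj, Nat.cast_inj, Fin.val_inj, π.injective.eq_iff] at h
  exact Fin.mk.inj_iff.1 h

theorem word_nonneg {n : ℕ} (π : Equiv.Perm (Fin n)) (i : ℕ) : 0 ≤ word π i := by
  unfold word; split_ifs <;> positivity

theorem word_lt {n : ℕ} (π : Equiv.Perm (Fin n)) {i : ℕ} (h : i < n) : word π i < n := by
  rw [word_of_lt π h]; exact_mod_cast (π ⟨i, h⟩).isLt

theorem word_injective {n : ℕ} : Function.Injective (word (n := n)) := by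
  intro π ρ h
  ext i
  have := congrFun h i
  rw [word_of_lt π i.isLt, word_of_lt ρ i.isLt] at this
  exact_mod_cast this

theorem sum_word {n : ℕ} (π : Equiv.Perm (Fin n)) :
    ∑ i ∈ Finset.range n, word π i = ∑ i : Fin n, ((i : ℕ) : ℤ) := by
  rw [Finset.sum_range, ← Equiv.sum_comp π fun i : Fin n => ((i : ℕ) : ℤ)]
  exact Finset.sum_congr rfl fun i _ => word_of_lt π i.isLt

/-! ### The forbidden patterns and their clusters -/

/-- The patterns `132`, `213`, `321`, `2341`. -/
inductive Pattern
  | t132 | t213 | t321 | t2341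
  deriving DecidableEq

namespace Pattern

instance : Fintype Pattern where
  elems := {t132, t213, t321, t2341}
  complete r := by cases r <;> decide

/-- The number of letters of a pattern. -/
def size : Pattern → ℕ
  | t132 => 3
  | t213 => 3
  | t321 => 3
  | t2341 => 4

/-- The letters, relative to the first one, of the chains of overlapping patterns that start with
a given pattern; the first letters of the chain are those of the pattern. -/
def shape : Pattern → ℕ → ℤ
  | t132, i => i + if i % 3 = 1 then 1 else if i % 3 = 2 then -1 else 0
  | t213, i => i - if i % 3 = 1 then 2 else if i % 3 = 2 then 1 else 0
  | t321, i => -i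
  | t2341, i => if i < 3 then i else 2 - i

/-- The rearrangement that turns `132`, `213`, `321` into `123`, and `2341` into `4123`. -/
def source : Pattern → ℕ → ℕ
  | t132, i => if i = 1 then 2 else if i = 2 then 1 else i
  | t213, i => if i = 0 then 1 else if i = 1 then 0 else i
  | t321, i => 2 - i
  | t2341, i => (i + 2) % 4

theorem source_lt (r : Pattern) {i : ℕ} (h : i < r.size) : r.source i < r.size := by
  cases r <;> simp only [source, size] at * <;> (try split_ifs) <;> omega

theorem source_source (r : Pattern) {i : ℕ} (h : i < r.size) : r.source (r.source i) = i := by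
  cases r <;> simp only [size] at h <;> interval_cases i <;> rfl

theorem size_pos (r : Pattern) : 0 < r.size := by cases r <;> decide

theorem three_le_size (r : Pattern) : 3 ≤ r.size := by cases r <;> decide

@[simp] theorem shape_zero (r : Pattern) : r.shape 0 = 0 := by cases r <;> rfl

end Pattern

/-- The letters of `f` at the `k` positions from `d` on, all of them below `n`, have the relative
order and distances prescribed by `s`. -/
def HasShape (n : ℕ) (s : ℕ → ℤ) (k : ℕ) (f : ℕ → ℤ) (d : ℕ) : Prop :=
  d + k ≤ n ∧ ∀ i < k, f (d + i) = f d + s i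

/-- Measuring letters from the first one eliminates the unknown translation constant; `b` is the
first letter of `τ`. -/
theorem occursAt_iff {k n : ℕ} (τ : Equiv.Perm (Fin k)) (π : Equiv.Perm (Fin n)) (d : ℕ)
    (s : ℕ → ℤ) (b : ℤ) (hk : 0 < k) (h0 : s 0 = 0)
    (h : ∀ i : Fin k, ((τ i : ℕ) : ℤ) = b + s i) :
    OccursAt τ π d ↔ HasShape n s k (word π) d := by
  constructor
  · rintro ⟨hd, c, hc⟩
    have key : ∀ i < k, word π (d + i) = b + s i - c := fun i hi => by
      have h1 := hc ⟨i, hi⟩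
      have h2 := h ⟨i, hi⟩
      rw [word_of_lt π (by omega)]
      simp only at h1 h2 ⊢
      omega
    refine ⟨hd, fun i hi => ?_⟩
    have h1 := key 0 hk
    rw [key i hi]
    rw [add_zero] at h1
    omega
  · rintro ⟨hd, hs⟩
    refine ⟨hd, b - word π d, fun i => ?_⟩
    have h1 := hs i i.isLt
    rw [word_of_lt π (by omega)] at h1
    rw [h1, h i]
    ring

theorem occursAt_p123 {n : ℕ} (π : Equiv.Perm (Fin n)) (d : ℕ) :
    OccursAt p123 π d ↔ HasShape n (fun i => i) 3 (word π) d :=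
  occursAt_iff _ _ _ _ 0 (by decide) rfl (by decide)

theorem occursAt_p132 {n : ℕ} (π : Equiv.Perm (Fin n)) (d : ℕ) :
    OccursAt p132 π d ↔ HasShape n Pattern.t132.shape 3 (word π) d :=
  occursAt_iff _ _ _ _ 0 (by decide) rfl (by decide)

theorem occursAt_p213 {n : ℕ} (π : Equiv.Perm (Fin n)) (d : ℕ) :
    OccursAt p213 π d ↔ HasShape n Pattern.t213.shape 3 (word π) d :=
  occursAt_iff _ _ _ _ 1 (by decide) rfl (by decide)

theorem occursAt_p321 {n : ℕ} (π : Equiv.Perm (Fin n)) (d : ℕ) :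
    OccursAt p321 π d ↔ HasShape n Pattern.t321.shape 3 (word π) d :=
  occursAt_iff _ _ _ _ 2 (by decide) rfl (by decide)

theorem occursAt_p2341 {n : ℕ} (π : Equiv.Perm (Fin n)) (d : ℕ) :
    OccursAt p2341 π d ↔ HasShape n Pattern.t2341.shape 4 (word π) d :=
  occursAt_iff _ _ _ _ 1 (by decide) rfl (by decide)

/-- An occurrence of one of the forbidden patterns in a word of length `n`. -/
def Occ (n : ℕ) (r : Pattern) (f : ℕ → ℤ) (d : ℕ) : Prop := HasShape n r.shape r.size f d

theorem mem_avoiders_iff {n : ℕ} (π : Equiv.Perm (Fin n)) :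
    π ∈ avoiders n ↔ ∀ r d, ¬ Occ n r (word π) d := by
  simp only [avoiders, Avoids, Set.mem_ofPred_eq, occursAt_p132, occursAt_p213, occursAt_p321,
    occursAt_p2341]
  constructor
  · rintro ⟨h1, h2, h3, h4⟩ (_ | _ | _ | _) d
    exacts [h1 d, h2 d, h3 d, h4 d]
  · intro h
    exact ⟨h .t132, h .t213, h .t321, h .t2341⟩

/-- The letters of `f` below `n` are distinct. -/
def Distinct (n : ℕ) (f : ℕ → ℤ) : Prop := ∀ i < n, ∀ j < n, f i = f j → i = j

theorem distinct_word {n : ℕ} (π : Equiv.Perm (Fin n)) : Distinct n (word π) :=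
  fun _ hi _ hj => word_inj π hi hj

/-- In a word with distinct letters two occurrences of forbidden patterns overlap in few ways. -/
theorem overlap_cases {n : ℕ} {f : ℕ → ℤ} (hf : Distinct n f) {r s : Pattern} {d e : ℕ}
    (hr : Occ n r f d) (hs : Occ n s f (d + e)) (he : e < r.size) :
    (e = 0 ∧ r = s) ∨ (e = 1 ∧ r = .t132 ∧ s = .t213) ∨ (e = 2 ∧ r = .t213 ∧ s = .t132) ∨
      (e = 1 ∧ r = .t321 ∧ s = .t321) ∨ (e = 2 ∧ r = .t321 ∧ s = .t321) ∨
      (e = 3 ∧ r = .t2341 ∧ s = .t321) := by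
  obtain ⟨hn, hr⟩ := hr
  obtain ⟨hm, hs⟩ := hs
  have clash : ∀ i j, i < j → d + j < n → f (d + i) = f (d + j) → False := fun i j hij hj h => by
    have := hf _ (by omega) _ hj h
    omega
  have letters : ∀ (t : Pattern) (c : ℕ), (∀ i < t.size, f (c + i) = f c + t.shape i) →
      (t = .t132 ∧ f (c + 1) = f c + 2 ∧ f (c + 2) = f c + 1) ∨
      (t = .t213 ∧ f (c + 1) = f c - 1 ∧ f (c + 2) = f c + 1) ∨
      (t = .t321 ∧ f (c + 1) = f c - 1 ∧ f (c + 2) = f c - 2) ∨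
      (t = .t2341 ∧ f (c + 1) = f c + 1 ∧ f (c + 2) = f c + 2 ∧ f (c + 3) = f c - 1) := by
    intro t c ht
    have h1 := ht 1 (by cases t <;> decide)
    have h2 := ht 2 (by cases t <;> decide)
    cases t
    · exact .inl ⟨rfl, h1, h2⟩
    · exact .inr (.inl ⟨rfl, h1, h2⟩)
    · exact .inr (.inr (.inl ⟨rfl, h1, h2⟩))
    · exact .inr (.inr (.inr ⟨rfl, h1, h2, ht 3 (by decide)⟩))
  have he3 : e < 4 := by cases r <;> simp only [Pattern.size] at he <;> omega
  have hr' := letters r d hr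
  have hs' := letters s (d + e) hs
  simp only [add_assoc] at hs'
  clear letters hr hs hf
  have clash0 := clash 0
  rw [add_zero] at clash0
  rcases hr' with ⟨rfl, hr'⟩ | ⟨rfl, hr'⟩ | ⟨rfl, hr'⟩ | ⟨rfl, hr'⟩ <;>
    rcases hs' with ⟨rfl, hs'⟩ | ⟨rfl, hs'⟩ | ⟨rfl, hs'⟩ | ⟨rfl, hs'⟩ <;>
    simp only [Pattern.size] at he hn hm <;>
    interval_cases e <;>
    simp only [add_zero, Nat.reduceAdd] at hs' <;>
    -- Every overlap not listed either prescribes incompatible differences between shared letters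
    -- (`omega`) or repeats a letter at two distinct positions (`clash`).
    first
    | (exfalso; omega)
    | exact (clash0 2 (by omega) (by omega) (by omega)).elim
    | exact (clash0 3 (by omega) (by omega) (by omega)).elim
    | exact (clash0 4 (by omega) (by omega) (by omega)).elim
    | exact (clash 1 3 (by omega) (by omega) (by omega)).elim
    | exact (clash 1 4 (by omega) (by omega) (by omega)).elim
    | exact (clash 2 4 (by omega) (by omega) (by omega)).elim
    | exact (clash 2 5 (by omega) (by omega) (by omega)).elim
    | exact (clash0 5 (by omega) (by omega) (by omega)).elim
    | exact (clash 1 5 (by omega) (by omega) (by omega)).elim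
    | simp

open Relation

/-! ### The rewriting system -/

/-- The function `f` with the letters at the positions `d, d + 1, …` rearranged according to the
rule belonging to the pattern `r`. -/
def rearrange (r : Pattern) (d : ℕ) (f : ℕ → ℤ) (j : ℕ) : ℤ :=
  if d ≤ j ∧ j < d + r.size then f (d + r.source (j - d)) else f j

theorem rearrange_add (r : Pattern) (d : ℕ) (f : ℕ → ℤ) {i : ℕ} (h : i < r.size) :
    rearrange r d f (d + i) = f (d + r.source i) := by
  rw [rearrange, if_pos ⟨by omega, by omega⟩, Nat.add_sub_cancel_left]

theorem rearrange_of_not (r : Pattern) (d : ℕ) (f : ℕ → ℤ) {j : ℕ} (h : j < d ∨ d + r.size ≤ j) :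
    rearrange r d f j = f j :=
  if_neg (by omega)

theorem rearrange_comm (r s : Pattern) (d e : ℕ) (f : ℕ → ℤ) (h : d + r.size ≤ e) :
    rearrange r d (rearrange s e f) = rearrange s e (rearrange r d f) := by
  funext j
  rcases lt_or_ge j (d + r.size) with hj | hj
  · rw [rearrange_of_not s e _ (by omega)]
    unfold rearrange
    split_ifs with h1 h2
    · have := r.source_lt (i := j - d) (by omega)
      omega
    · rfl
    · omega
    · rfl
  · rw [rearrange_of_not r d _ (by omega)]
    unfold rearrange
    split_ifs with h1 h2
    · omega
    · rfl
    · omega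
    · rfl

theorem exists_word_eq_rearrange {n : ℕ} (π : Equiv.Perm (Fin n)) (r : Pattern) {d : ℕ}
    (hd : d + r.size ≤ n) : ∃ ρ : Equiv.Perm (Fin n), word ρ = rearrange r d (word π) := by
  let τ : Fin n → Fin n := fun j =>
    if h : d ≤ (j : ℕ) ∧ (j : ℕ) < d + r.size then
      ⟨d + r.source (j - d), by have := r.source_lt (i := j - d) (by omega); omega⟩ else j
  have hτ : Function.Involutive τ := by
    intro j
    by_cases h : d ≤ (j : ℕ) ∧ (j : ℕ) < d + r.size
    · have h1 := r.source_lt (i := j - d) (by omega)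
      have h2 := r.source_source (i := j - d) (by omega)
      have e1 : τ j = ⟨d + r.source (j - d), by omega⟩ := dif_pos h
      have e2 : τ (τ j) = ⟨d + r.source (τ j - d), by
          rw [e1]; simp only [Nat.add_sub_cancel_left, h2]; omega⟩ :=
        dif_pos (by rw [e1]; simp only; omega)
      rw [e2]
      ext
      simp only [e1, Nat.add_sub_cancel_left, h2]
      omega
    · have e1 : τ j = j := dif_neg h
      rw [e1, e1]
  refine ⟨hτ.toPerm.trans π, ?_⟩
  funext j
  by_cases hj : j < n
  · rw [word_of_lt _ hj]
    unfold rearrange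
    by_cases h : d ≤ j ∧ j < d + r.size
    · have h1 := r.source_lt (i := j - d) (by omega)
      have e1 : τ ⟨j, hj⟩ = ⟨d + r.source (j - d), by omega⟩ := dif_pos h
      rw [if_pos h, word_of_lt _ (by omega), Equiv.trans_apply, Function.Involutive.coe_toPerm, e1]
    · have e1 : τ ⟨j, hj⟩ = ⟨j, hj⟩ := dif_neg h
      rw [if_neg h, word_of_lt _ hj, Equiv.trans_apply, Function.Involutive.coe_toPerm, e1]
  · rw [word_of_le _ (by omega), rearrange_of_not _ _ _ (by omega), word_of_le _ (by omega)]

/-- One step of the rewriting system `132 → 123`, `213 → 123`, `321 → 123`, `2341 → 4123` on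
words of length `n`. -/
def WordStep (n : ℕ) (f g : ℕ → ℤ) : Prop := ∃ r d, Occ n r f d ∧ g = rearrange r d f

/-- The words `f` and `g` agree outside the `K` positions from `d` on, where `g` has the letters
`f d + c i`. -/
def Window (d K : ℕ) (f c g : ℕ → ℤ) : Prop :=
  (∀ j, j < d ∨ d + K ≤ j → g j = f j) ∧ ∀ i < K, g (d + i) = f d + c i

theorem Window.rearrange {d K e : ℕ} {f c g : ℕ → ℤ} {r : Pattern} (h : Window d K f c g)
    (he : e + r.size ≤ K) :
    Window d K f (rearrange r e c) (Hertzsprung.rearrange r (d + e) g) := by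
  refine ⟨fun j hj => ?_, fun i hi => ?_⟩
  · rw [rearrange_of_not _ _ _ (by omega), h.1 j hj]
  · by_cases hie : e ≤ i ∧ i < e + r.size
    · obtain ⟨i, rfl⟩ := Nat.exists_eq_add_of_le hie.1
      have := r.source_lt (i := i) (by omega)
      rw [← add_assoc, rearrange_add _ _ _ (by omega), rearrange_add _ _ _ (by omega), add_assoc,
        h.2 _ (by omega)]
    · rw [rearrange_of_not _ _ _ (by omega), rearrange_of_not _ _ _ (by omega), h.2 i hi]

theorem Window.wordStep {n d K e : ℕ} {f c g : ℕ → ℤ} {r : Pattern} (h : Window d K f c g)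
    (hn : d + K ≤ n) (he : e + r.size ≤ K) (hc : ∀ i < r.size, c (e + i) = c e + r.shape i) :
    WordStep n g (Hertzsprung.rearrange r (d + e) g) := by
  refine ⟨r, d + e, ⟨by omega, fun i hi => ?_⟩, rfl⟩
  have := r.size_pos
  rw [add_assoc, h.2 _ (by omega), h.2 _ (by omega), hc i hi, add_assoc]

/-- A list of rewriting steps, given by patterns and positions, can be carried out on the first
`K` letters of `c`. -/
def ValidPath (K : ℕ) : List (Pattern × ℕ) → (ℕ → ℤ) → Prop
  | [], _ => True
  | (r, e) :: l, c => e + r.size ≤ K ∧ (∀ i < r.size, c (e + i) = c e + r.shape i) ∧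
      ValidPath K l (rearrange r e c)

instance (K : ℕ) : ∀ (l : List (Pattern × ℕ)) (c : ℕ → ℤ), Decidable (ValidPath K l c)
  | [], _ => inferInstanceAs (Decidable True)
  | (r, e) :: l, c =>
    haveI := instDecidableValidPath K l (rearrange r e c)
    inferInstanceAs (Decidable (_ ∧ _ ∧ _))

/-- The result of a list of rewriting steps. -/
def runPath : List (Pattern × ℕ) → (ℕ → ℤ) → ℕ → ℤ
  | [], c => c
  | (r, e) :: l, c => runPath l (rearrange r e c)

theorem Window.exists_path {n d K : ℕ} {f : ℕ → ℤ} (hn : d + K ≤ n) :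
    ∀ (l : List (Pattern × ℕ)) (c g : ℕ → ℤ), Window d K f c g → ValidPath K l c →
      ∃ g', ReflTransGen (WordStep n) g g' ∧ Window d K f (runPath l c) g'
  | [], _, g, h, _ => ⟨g, .refl, h⟩
  | (_, _) :: l, _, _, h, ⟨he, hc, hl⟩ => by
    obtain ⟨g', h1, h2⟩ := exists_path hn l _ _ (h.rearrange he) hl
    exact ⟨g', .head (h.wordStep hn he hc) h1, h2⟩

theorem Window.unique {d K : ℕ} {f c c' g g' : ℕ → ℤ} (h : Window d K f c g)
    (h' : Window d K f c' g') (hc : ∀ i < K, c i = c' i) : g = g' := by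
  funext j
  by_cases hj : j < d ∨ d + K ≤ j
  · rw [h.1 j hj, h'.1 j hj]
  · obtain ⟨i, rfl⟩ := Nat.exists_eq_add_of_le (show d ≤ j by omega)
    rw [h.2 i (by omega), h'.2 i (by omega), hc i (by omega)]

/-- Reduces joining a critical pair to a computation with the relative letters `c` on `K` positions:
the base letter and the rest of the word play no role, so the hypotheses on the paths can be settled
by `decide`. -/
theorem join_of_path {n d K : ℕ} {f c : ℕ → ℤ} {r s : Pattern} {e : ℕ} (hn : d + K ≤ n)
    (hf : ∀ i < K, f (d + i) = f d + c i) (l l' : List (Pattern × ℕ))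
    (hl : r.size ≤ K ∧ ValidPath K l (rearrange r 0 c))
    (hl' : e + s.size ≤ K ∧ ValidPath K l' (rearrange s e c))
    (h : ∀ i < K, runPath l (rearrange r 0 c) i = runPath l' (rearrange s e c) i) :
    Join (ReflTransGen (WordStep n)) (rearrange r d f) (rearrange s (d + e) f) := by
  have w : Window d K f c f := ⟨fun _ _ => rfl, hf⟩
  obtain ⟨g, hg, wg⟩ := Window.exists_path hn l _ _ (w.rearrange (e := 0) (by omega)) hl.2
  obtain ⟨g', hg', wg'⟩ := Window.exists_path hn l' _ _ (w.rearrange hl'.1) hl'.2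
  obtain rfl := wg.unique wg' h
  exact ⟨g, hg, hg'⟩

theorem HasShape.append {n k l e : ℕ} {s t u : ℕ → ℤ} {f : ℕ → ℤ} {d : ℕ}
    (h : HasShape n s k f d) (h' : HasShape n t l f (d + e)) (he : e < k)
    (hs : ∀ i < k, u i = s i) (ht : ∀ i < l, u (e + i) = s e + t i) :
    ∀ i < e + l, f (d + i) = f d + u i := by
  intro i hi
  by_cases hik : i < k
  · rw [hs i hik, h.2 i hik]
  · obtain ⟨j, rfl⟩ := Nat.exists_eq_add_of_le (show e ≤ i by omega)
    rw [← add_assoc, h'.2 j (by omega), ht j (by omega), h.2 e he, add_assoc]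

/-- Disjoint occurrences commute. The overlapping ones live on the words 1324, 21354, 4321, 54321
and 456321, with common reducts 1234, 12345, 4123, 54123 and 456123 respectively. -/
theorem rearrange_join_of_le {n : ℕ} {f : ℕ → ℤ} (hf : Distinct n f) {r s : Pattern} {d e : ℕ}
    (hr : Occ n r f d) (hs : Occ n s f (d + e)) :
    Join (ReflTransGen (WordStep n)) (rearrange r d f) (rearrange s (d + e) f) := by
  by_cases he : r.size ≤ e
  · refine ⟨rearrange s (d + e) (rearrange r d f), .single ⟨s, d + e, ⟨hs.1, fun i hi => ?_⟩, rfl⟩,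
      .single ⟨r, d, ⟨hr.1, fun i hi => ?_⟩, (rearrange_comm r s d _ f (by omega)).symm⟩⟩
    · rw [rearrange_of_not _ _ _ (by omega), rearrange_of_not _ _ _ (by omega), hs.2 i hi]
    · rw [rearrange_of_not _ _ _ (by omega), rearrange_of_not _ _ _ (by omega), hr.2 i hi]
  · rcases overlap_cases hf hr hs (by omega) with ⟨rfl, rfl⟩ | ⟨rfl, rfl, rfl⟩ | ⟨rfl, rfl, rfl⟩ |
      ⟨rfl, rfl, rfl⟩ | ⟨rfl, rfl, rfl⟩ | ⟨rfl, rfl, rfl⟩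
    · exact ⟨_, .refl, .refl⟩
    · exact join_of_path (K := 4) hs.1
        (hr.append hs (u := Pattern.shape .t132) (by decide) (fun _ _ => rfl) (by decide))
        [] [] (by decide) (by decide) (by decide)
    · exact join_of_path (K := 5) hs.1
        (hr.append hs (u := Pattern.shape .t213) (by decide) (fun _ _ => rfl) (by decide))
        [(.t132, 2)] [(.t213, 0)] (by decide) (by decide) (by decide)
    · exact join_of_path (K := 4) hs.1
        (hr.append hs (u := Pattern.shape .t321) (by decide) (fun _ _ => rfl) (by decide))
        [(.t2341, 0)] [] (by decide) (by decide) (by decide)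
    · exact join_of_path (K := 5) hs.1
        (hr.append hs (u := Pattern.shape .t321) (by decide) (fun _ _ => rfl) (by decide))
        [(.t2341, 0), (.t2341, 1)] [] (by decide) (by decide) (by decide)
    -- 456321 → 634521 → 652341 → 654123 → 456123 on one side, 456321 → 456123 on the other.
    · exact join_of_path (K := 6) hs.1
        (hr.append hs (u := Pattern.shape .t2341) (by decide) (fun _ _ => rfl) (by decide))
        [(.t2341, 1), (.t2341, 2), (.t321, 0)] [] (by decide) (by decide) (by decide)

theorem wordStep_locally_confluent {n : ℕ} {f g h : ℕ → ℤ} (hf : Distinct n f)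
    (hg : WordStep n f g) (hh : WordStep n f h) : Join (ReflTransGen (WordStep n)) g h := by
  obtain ⟨r, d, hr, rfl⟩ := hg
  obtain ⟨s, e, hs, rfl⟩ := hh
  rcases le_total d e with hde | hde
  · obtain ⟨e, rfl⟩ := Nat.exists_eq_add_of_le hde
    exact rearrange_join_of_le hf hr hs
  · obtain ⟨d, rfl⟩ := Nat.exists_eq_add_of_le hde
    obtain ⟨k, h1, h2⟩ := rearrange_join_of_le hf hs hr
    exact ⟨k, h2, h1⟩

/-! ### Rewriting of permutations -/

/-- One step of the rewriting system on permutations. -/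
def Step {n : ℕ} (π ρ : Equiv.Perm (Fin n)) : Prop := WordStep n (word π) (word ρ)

theorem exists_step_of_occ {n : ℕ} {π : Equiv.Perm (Fin n)} {r : Pattern} {d : ℕ}
    (h : Occ n r (word π) d) : ∃ ρ, Step π ρ ∧ word ρ = rearrange r d (word π) := by
  obtain ⟨ρ, hρ⟩ := exists_word_eq_rearrange π r h.1
  exact ⟨ρ, ⟨r, d, h, hρ⟩, hρ⟩

theorem exists_of_wordSteps {n : ℕ} {π : Equiv.Perm (Fin n)} {g : ℕ → ℤ}
    (h : ReflTransGen (WordStep n) (word π) g) :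
    ∃ ρ : Equiv.Perm (Fin n), word ρ = g ∧ ReflTransGen Step π ρ := by
  induction h with
  | refl => exact ⟨π, rfl, .refl⟩
  | tail _ h ih =>
    obtain ⟨ρ, rfl, hρ⟩ := ih
    obtain ⟨r, d, ho, rfl⟩ := h
    obtain ⟨ρ', h1, h2⟩ := exists_step_of_occ ho
    exact ⟨ρ', h2, hρ.tail h1⟩

theorem step_locally_confluent {n : ℕ} {π ρ σ : Equiv.Perm (Fin n)} (h : Step π ρ)
    (h' : Step π σ) : Join (ReflTransGen Step) ρ σ := by
  obtain ⟨g, h1, h2⟩ := wordStep_locally_confluent (distinct_word π) h h'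
  obtain ⟨τ, rfl, h3⟩ := exists_of_wordSteps h1
  obtain ⟨τ', h4, h5⟩ := exists_of_wordSteps h2
  rw [word_injective h4] at h5
  exact ⟨τ, h3, h5⟩

/-! ### Termination, confluence and irreducible permutations -/

/-- Each rule moves large letters to the right. Linear weights `i` would not do, since 2341 and 4123
have the same weighted sum; squares break this tie. -/
theorem sum_lt_of_wordStep {n : ℕ} {f g : ℕ → ℤ} (h : WordStep n f g) :
    ∑ i ∈ Finset.range n, (i : ℤ) ^ 2 * f i < ∑ i ∈ Finset.range n, (i : ℤ) ^ 2 * g i := by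
  obtain ⟨r, d, ⟨hn, h⟩, rfl⟩ := h
  rw [← sub_pos, ← Finset.sum_sub_distrib]
  have hsub : Finset.Ico d (d + r.size) ⊆ Finset.range n := fun i hi => by
    simp only [Finset.mem_Ico, Finset.mem_range] at *; omega
  rw [← Finset.sum_subset hsub fun i _ hi => by
    rw [rearrange_of_not _ _ _ (by simp only [Finset.mem_Ico] at hi; omega), sub_self],
    Finset.sum_Ico_eq_sum_range, Nat.add_sub_cancel_left]
  have : ∑ i ∈ Finset.range r.size, (((d + i : ℕ) : ℤ) ^ 2 * rearrange r d f (d + i) -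
        ((d + i : ℕ) : ℤ) ^ 2 * f (d + i)) =
      ∑ i ∈ Finset.range r.size, ((d + i : ℕ) : ℤ) ^ 2 * (r.shape (r.source i) - r.shape i) := by
    refine Finset.sum_congr rfl fun i hi => ?_
    rw [Finset.mem_range] at hi
    rw [rearrange_add _ _ _ hi, h _ (r.source_lt hi), h i hi]
    ring
  rw [this]
  cases r <;> simp [Finset.sum_range_succ, Pattern.size, Pattern.shape, Pattern.source] <;>
    nlinarith

theorem wellFounded_step (n : ℕ) :
    WellFounded fun ρ π : Equiv.Perm (Fin n) => Step π ρ := by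
  let Φ : Equiv.Perm (Fin n) → ℤ := fun π => ∑ i ∈ Finset.range n, (i : ℤ) ^ 2 * word π i
  have : IsTrans (Equiv.Perm (Fin n)) fun ρ π => Φ π < Φ ρ := ⟨fun _ _ _ h h' => h'.trans h⟩
  have : Std.Irrefl fun ρ π : Equiv.Perm (Fin n) => Φ π < Φ ρ := ⟨fun _ => lt_irrefl _⟩
  exact Subrelation.wf (fun h => sum_lt_of_wordStep h)
    (Finite.wellFounded_of_trans_of_irrefl fun ρ π => Φ π < Φ ρ)

/-- Newman's lemma. -/
theorem confluent_of_locally_confluent {α : Type*} {r : α → α → Prop}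
    (wf : WellFounded fun b a => r a b)
    (lc : ∀ a b c, r a b → r a c → Join (ReflTransGen r) b c) (a b c : α)
    (hb : ReflTransGen r a b) (hc : ReflTransGen r a c) : Join (ReflTransGen r) b c := by
  induction a using wf.induction generalizing b c with
  | _ a ih =>
    rcases hb.cases_head with rfl | ⟨b₁, hab, hb⟩
    · exact ⟨c, hc, .refl⟩
    rcases hc.cases_head with rfl | ⟨c₁, hac, hc⟩
    · exact ⟨b, .refl, .head hab hb⟩
    obtain ⟨d, hbd, hcd⟩ := lc a b₁ c₁ hab hac
    obtain ⟨e, hbe, hde⟩ := ih b₁ hab b d hb hbd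
    obtain ⟨x, hex, hcx⟩ := ih c₁ hac e c (hcd.trans hde) hc
    exact ⟨x, hbe.trans hex, hcx⟩

theorem mem_avoiders_iff_not_step {n : ℕ} (π : Equiv.Perm (Fin n)) :
    π ∈ avoiders n ↔ ∀ ρ, ¬ Step π ρ := by
  rw [mem_avoiders_iff]
  constructor
  · rintro h ρ ⟨r, d, ho, -⟩
    exact h r d ho
  · intro h r d ho
    obtain ⟨ρ, hρ, -⟩ := exists_step_of_occ ho
    exact h ρ hρ

theorem exists_avoider_of_steps {n : ℕ} (π : Equiv.Perm (Fin n)) :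
    ∃ ρ ∈ avoiders n, ReflTransGen Step π ρ := by
  induction π using (wellFounded_step n).induction with
  | _ π ih =>
    by_cases h : π ∈ avoiders n
    · exact ⟨π, h, .refl⟩
    · rw [mem_avoiders_iff_not_step] at h
      push Not at h
      obtain ⟨ρ, hρ⟩ := h
      obtain ⟨σ, hσ, h'⟩ := ih ρ hρ
      exact ⟨σ, hσ, .head hρ h'⟩

/-- By confluence joinability is an equivalence relation, hence contains the one generated by
`Step`; an irreducible element reduces only to itself. -/
theorem eq_of_eqvGen_step {n : ℕ} {π ρ : Equiv.Perm (Fin n)} (hπ : π ∈ avoiders n)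
    (hρ : ρ ∈ avoiders n) (h : EqvGen Step π ρ) : π = ρ := by
  have heq := equivalence_join (confluent_of_locally_confluent (wellFounded_step n)
    fun _ _ _ => step_locally_confluent)
  have hj : Join (ReflTransGen Step) π ρ := heq.eqvGen_iff.1 (h.mono fun a b hab =>
    ⟨b, .single hab, .refl⟩)
  obtain ⟨σ, h1, h2⟩ := hj
  rw [mem_avoiders_iff_not_step] at hπ hρ
  rcases h1.cases_head with rfl | ⟨_, h, _⟩
  · rcases h2.cases_head with rfl | ⟨_, h, _⟩
    · rfl
    · exact (hρ _ h).elim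
  · exact (hπ _ h).elim

/-! ### The equivalence classes -/

/-- The four patterns declared equivalent. -/
abbrev equated : Set (Equiv.Perm (Fin 3)) := {p123, p132, p213, p321}

theorem replace_of_rearrange {n : ℕ} {π ρ : Equiv.Perm (Fin n)} {d : ℕ}
    {α β : Equiv.Perm (Fin 3)} {r : Pattern} (hr : r.size = 3) (hα : α ∈ equated)
    (hβ : β ∈ equated) (ha : OccursAt α π d) (hb : OccursAt β ρ d)
    (h : word ρ = rearrange r d (word π)) : Replace equated π ρ := by
  refine ⟨α, hα, β, hβ, d, ha, hb, fun j hj => ?_⟩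
  have := congrFun h j
  rw [rearrange_of_not _ _ _ (by omega), word_of_lt _ j.isLt, word_of_lt _ j.isLt] at this
  exact Fin.ext (by exact_mod_cast this.symm)

theorem occursAt_p123_rearrange {n : ℕ} {π ρ : Equiv.Perm (Fin n)} {d : ℕ} {r : Pattern}
    (hr : r.size = 3) (ho : Occ n r (word π) d) (h : word ρ = rearrange r d (word π)) :
    OccursAt p123 ρ d := by
  rw [occursAt_p123]
  have hn := ho.1
  refine ⟨by omega, fun i hi => ?_⟩
  have h0 := rearrange_add r d (word π) r.size_pos
  rw [add_zero] at h0
  rw [h, rearrange_add _ _ _ (by omega), h0, ho.2 _ (r.source_lt (by omega)),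
    ho.2 _ (r.source_lt (by omega)), add_assoc]
  congr 1
  cases r <;> simp only [Pattern.size] at hr <;> first | omega | (interval_cases i <;> decide)

theorem eqvSetoid_of_step {n : ℕ} {π ρ : Equiv.Perm (Fin n)} (h : Step π ρ) :
    (eqvSetoid n) π ρ := by
  obtain ⟨r, d, ho, h⟩ := h
  have small : ∀ {α : Equiv.Perm (Fin 3)}, α ∈ equated → r.size = 3 → OccursAt α π d →
      (eqvSetoid n) π ρ := fun hα hr ha => EqvGen.rel _ _
    (replace_of_rearrange hr hα (by simp) ha (occursAt_p123_rearrange hr ho h) h)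
  cases r with
  | t132 => exact small (α := p132) (by simp) rfl ((occursAt_p132 π d).2 ho)
  | t213 => exact small (α := p213) (by simp) rfl ((occursAt_p213 π d).2 ho)
  | t321 => exact small (α := p321) (by simp) rfl ((occursAt_p321 π d).2 ho)
  | t2341 =>
    obtain ⟨hn, hs⟩ := ho
    simp only [Pattern.size] at hn hs
    -- The rule 2341 → 4123 is simulated through `σ` = 4321: replace 123 by 321 at `d`, then 321 by
    -- 123 at `d + 1`.
    obtain ⟨σ, hσ⟩ := exists_word_eq_rearrange π .t321 (d := d) (by simp only [Pattern.size]; omega)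
    have e0 : word σ (d + 0) = word π (d + 2) := by
      rw [hσ, rearrange_add _ _ _ (by decide)]; rfl
    have e1 : word σ (d + 1) = word π (d + 1) := by
      rw [hσ, rearrange_add _ _ _ (by decide)]; rfl
    have e2 : word σ (d + 2) = word π (d + 0) := by
      rw [hσ, rearrange_add _ _ _ (by decide)]; rfl
    have e3 : word σ (d + 3) = word π (d + 3) := by
      rw [hσ, rearrange_of_not _ _ _ (by simp [Pattern.size])]
    have f1 : word π (d + 1) = word π d + 1 := hs 1 (by omega)
    have f2 : word π (d + 2) = word π d + 2 := hs 2 (by omega)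
    have f3 : word π (d + 3) = word π d + -1 := hs 3 (by omega)
    rw [add_zero] at e0 e2
    have o1 : OccursAt p123 π d := by
      rw [occursAt_p123]
      refine ⟨by omega, fun i hi => ?_⟩
      interval_cases i
      · simp
      · simpa using f1
      · simpa using f2
    have o2 : OccursAt p321 σ d := by
      rw [occursAt_p321]
      refine ⟨by omega, fun i hi => ?_⟩
      interval_cases i <;> simp [Pattern.shape] <;> omega
    have o3 : Occ n .t321 (word σ) (d + 1) := by
      refine ⟨by simp only [Pattern.size]; omega, fun i hi => ?_⟩
      simp only [Pattern.size] at hi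
      interval_cases i <;> simp [Pattern.shape, add_assoc] <;> omega
    have h' : word ρ = rearrange .t321 (d + 1) (word σ) := by
      rw [h]
      funext j
      by_cases hj : j < d ∨ d + 4 ≤ j
      · rw [rearrange_of_not _ _ _ hj, rearrange_of_not _ _ _ (by simp only [Pattern.size]; omega),
          hσ, rearrange_of_not _ _ _ (by simp only [Pattern.size]; omega)]
      · obtain ⟨i, rfl⟩ := Nat.exists_eq_add_of_le (show d ≤ j by omega)
        have hi : i < 4 := by omega
        rw [rearrange_add _ _ _ hi]
        interval_cases i
        · rw [rearrange_of_not _ _ _ (by omega), add_zero, e0]; rfl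
        · exact e3.symm.trans (rearrange_add .t321 (d + 1) (word σ) (i := 0) (by decide)).symm
        · exact e2.symm.trans (rearrange_add .t321 (d + 1) (word σ) (i := 1) (by decide)).symm
        · exact e1.symm.trans (rearrange_add .t321 (d + 1) (word σ) (i := 2) (by decide)).symm
    exact EqvGen.trans _ σ _
      (EqvGen.rel _ _ (replace_of_rearrange rfl (by simp) (by simp) o1 o2 hσ))
      (EqvGen.rel _ _ (replace_of_rearrange rfl (by simp) (by simp)
        ((occursAt_p321 _ _).2 o3) (occursAt_p123_rearrange rfl o3 h') h'))

/-- Brings either side of a replacement to 123 in the same window, where the two sides can be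
compared. -/
theorem exists_p123_of_equated {n : ℕ} {π : Equiv.Perm (Fin n)} {α : Equiv.Perm (Fin 3)} {d : ℕ}
    (hα : α ∈ equated) (h : OccursAt α π d) :
    ∃ ρ : Equiv.Perm (Fin n), EqvGen Step π ρ ∧ OccursAt p123 ρ d ∧
      ∀ j, j < d ∨ d + 3 ≤ j → word ρ j = word π j := by
  have main : ∀ r : Pattern, r.size = 3 → Occ n r (word π) d →
      ∃ ρ : Equiv.Perm (Fin n), EqvGen Step π ρ ∧ OccursAt p123 ρ d ∧
        ∀ j, j < d ∨ d + 3 ≤ j → word ρ j = word π j := by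
    intro r hr ho
    obtain ⟨ρ, h1, h2⟩ := exists_step_of_occ ho
    exact ⟨ρ, .rel _ _ h1, occursAt_p123_rearrange hr ho h2, fun j hj => by
      rw [h2, rearrange_of_not _ _ _ (by omega)]⟩
  rcases hα with rfl | rfl | rfl | rfl
  · exact ⟨π, .refl _, h, fun _ _ => rfl⟩
  · exact main .t132 rfl ((occursAt_p132 _ _).1 h)
  · exact main .t213 rfl ((occursAt_p213 _ _).1 h)
  · exact main .t321 rfl ((occursAt_p321 _ _).1 h)

/-- All permutations have the same letter sum, so agreement outside the window forces equal sums
inside it, and that sum fixes the base letter of 123. -/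
theorem eq_of_occursAt_p123 {n : ℕ} {π ρ : Equiv.Perm (Fin n)} {d : ℕ} (h : OccursAt p123 π d)
    (h' : OccursAt p123 ρ d) (heq : ∀ j, j < d ∨ d + 3 ≤ j → word π j = word ρ j) : π = ρ := by
  obtain ⟨hn, h⟩ := (occursAt_p123 _ _).1 h
  obtain ⟨-, h'⟩ := (occursAt_p123 _ _).1 h'
  have hsub : Finset.Ico d (d + 3) ⊆ Finset.range n := fun i hi => by
    simp only [Finset.mem_Ico, Finset.mem_range] at *; omega
  have hsum : ∑ i ∈ Finset.Ico d (d + 3), (word π i - word ρ i) = 0 := by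
    rw [Finset.sum_subset hsub fun i _ hi => by
      rw [heq i (by simp only [Finset.mem_Ico] at hi; omega), sub_self],
      Finset.sum_sub_distrib, sum_word, sum_word, sub_self]
  rw [Finset.sum_Ico_eq_sum_range, Nat.add_sub_cancel_left] at hsum
  have hconst : ∀ i ∈ Finset.range 3, word π (d + i) - word ρ (d + i) = word π d - word ρ d := by
    intro i hi
    rw [Finset.mem_range] at hi
    rw [h i hi, h' i hi]
    ring
  rw [Finset.sum_congr rfl hconst] at hsum
  simp only [Finset.sum_const, Finset.card_range, nsmul_eq_mul, Nat.cast_ofNat] at hsum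
  apply word_injective
  funext j
  by_cases hj : j < d ∨ d + 3 ≤ j
  · exact heq j hj
  · obtain ⟨i, rfl⟩ := Nat.exists_eq_add_of_le (show d ≤ j by omega)
    rw [h i (by omega), h' i (by omega)]
    omega

theorem eqvGen_step_of_replace {n : ℕ} {π ρ : Equiv.Perm (Fin n)} (h : Replace equated π ρ) :
    EqvGen Step π ρ := by
  obtain ⟨α, hα, β, hβ, d, ha, hb, h⟩ := h
  obtain ⟨π', h1, h2, h3⟩ := exists_p123_of_equated hα ha
  obtain ⟨ρ', h4, h5, h6⟩ := exists_p123_of_equated hβ hb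
  obtain rfl : π' = ρ' := eq_of_occursAt_p123 h2 h5 fun j hj => by
    rw [h3 j hj, h6 j hj]
    by_cases hjn : j < n
    · rw [word_of_lt _ hjn, word_of_lt _ hjn, h ⟨j, hjn⟩ hj]
    · rw [word_of_le _ (by omega), word_of_le _ (by omega)]
  exact h1.trans _ _ _ (h4.symm _ _)

theorem eqvGen_step_of_eqvSetoid {n : ℕ} {π ρ : Equiv.Perm (Fin n)} (h : (eqvSetoid n) π ρ) :
    EqvGen Step π ρ := by
  change EqvGen (Replace equated) π ρ at h
  induction h with
  | rel _ _ h => exact eqvGen_step_of_replace h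
  | refl => exact .refl _
  | symm _ _ _ ih => exact ih.symm _ _
  | trans _ _ _ _ _ ih ih' => exact ih.trans _ _ _ ih'

theorem existsUnique_avoider {n : ℕ} (π : Equiv.Perm (Fin n)) :
    ∃! ρ : Equiv.Perm (Fin n), ρ ∈ avoiders n ∧ (eqvSetoid n) π ρ := by
  obtain ⟨ρ, hρ, h⟩ := exists_avoider_of_steps π
  have hs : (eqvSetoid n) π ρ := by
    clear hρ
    induction h with
    | refl => exact (eqvSetoid n).refl _
    | tail _ h ih => exact (eqvSetoid n).trans ih (eqvSetoid_of_step h)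
  refine ⟨ρ, ⟨hρ, hs⟩, fun σ ⟨hσ, h'⟩ => ?_⟩
  exact eq_of_eqvGen_step hσ hρ
    (eqvGen_step_of_eqvSetoid ((eqvSetoid n).trans ((eqvSetoid n).symm h') hs))

theorem card_quotient_eqvSetoid (n : ℕ) :
    Nat.card (Quotient (eqvSetoid n)) = Nat.card (avoiders n) := by
  refine (Nat.card_congr (Equiv.ofBijective
    (fun ρ : avoiders n => (Quotient.mk (eqvSetoid n) ρ.1)) ⟨?_, ?_⟩)).symm
  · rintro ⟨ρ, hρ⟩ ⟨σ, hσ⟩ h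
    exact Subtype.ext (eq_of_eqvGen_step hρ hσ (eqvGen_step_of_eqvSetoid (Quotient.exact h)))
  · intro q
    obtain ⟨π, rfl⟩ := Quotient.exists_rep q
    obtain ⟨ρ, ⟨hρ, h⟩, -⟩ := existsUnique_avoider π
    exact ⟨⟨ρ, hρ⟩, Quotient.sound ((eqvSetoid n).symm h)⟩

/-! ### Permutations composed of prescribed blocks -/

theorem card_filter_perm_lt {m : ℕ} (ρ : Equiv.Perm (Fin m)) (c : Fin m) :
    (Finset.univ.filter fun i => ρ i < c).card = c := by
  rw [← Fin.card_Iio c, ← Finset.card_map ρ.toEmbedding]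
  congr 1
  ext x
  simp only [Finset.mem_map, Finset.mem_filter, Finset.mem_univ, true_and, Finset.mem_Iio]
  constructor
  · rintro ⟨i, hi, rfl⟩
    exact hi
  · intro hx
    exact ⟨ρ.symm x, by simpa using hx, by simp⟩

/-- Standardization: each index is sent to the number of smaller values. -/
theorem exists_perm_lt_iff {m : ℕ} {v : Fin m → ℤ} (hv : Function.Injective v) :
    ∃ ρ : Equiv.Perm (Fin m), ∀ i j, ρ i < ρ j ↔ v i < v j := by
  let rank : Fin m → ℕ := fun i => (Finset.univ.filter fun j => v j < v i).card
  have hlt : ∀ i j, v i < v j → rank i < rank j := fun i j h => by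
    refine Finset.card_lt_card ((Finset.ssubset_iff_of_subset fun x hx => ?_).2 ⟨i, ?_, ?_⟩)
    · simp only [Finset.mem_filter, Finset.mem_univ, true_and] at *
      exact hx.trans h
    · simpa using h
    · simp
  have hiff : ∀ i j, rank i < rank j ↔ v i < v j := fun i j => by
    refine ⟨fun h => ?_, hlt i j⟩
    by_contra hn
    rcases (not_lt.1 hn).lt_or_eq with h' | h'
    · exact absurd (hlt j i h') (by omega)
    · rw [hv h'] at h
      omega
  have hm : ∀ i, rank i < m := fun i => by
    have : (Finset.univ.filter fun j => v j < v i) ⊂ Finset.univ :=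
      (Finset.ssubset_iff_of_subset (Finset.subset_univ _)).2 ⟨i, by simp, by simp⟩
    simpa using Finset.card_lt_card this
  have hinj : Function.Injective fun i => (⟨rank i, hm i⟩ : Fin m) := fun i j h => by
    have h := Fin.mk.inj_iff.1 h
    by_contra hij
    rcases lt_or_gt_of_ne (hv.ne hij) with h' | h' <;> have := hlt _ _ h' <;> omega
  exact ⟨Equiv.ofBijective _ (Finite.injective_iff_bijective.1 hinj), fun i j => hiff i j⟩

theorem sum_word_lt {n : ℕ} (π : Equiv.Perm (Fin n)) {c : ℤ} (h0 : 0 ≤ c) (hc : c < n) :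
    ∑ p ∈ Finset.range n, (if word π p < c then (1 : ℤ) else 0) = c := by
  lift c to ℕ using h0
  have hc : c < n := by exact_mod_cast hc
  have := card_filter_perm_lt π ⟨c, hc⟩
  rw [Finset.sum_range, Finset.sum_boole]
  rw [← Finset.filter_congr (s := Finset.univ) (p := fun i => π i < ⟨c, hc⟩)
    fun i _ => by rw [word_of_lt π i.isLt, Nat.cast_lt]; rfl, this]

/-- The sum of the first `i` block lengths. -/
def offset (k : ℕ → ℕ) (i : ℕ) : ℕ := ∑ j ∈ Finset.range i, k j

theorem offset_succ (k : ℕ → ℕ) (i : ℕ) : offset k (i + 1) = offset k i + k i :=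
  Finset.sum_range_succ _ _

theorem offset_mono (k : ℕ → ℕ) : Monotone (offset k) :=
  monotone_nat_of_le_succ fun i => by rw [offset_succ]; omega

theorem offset_add_le (k : ℕ → ℕ) {i j : ℕ} (h : i < j) : offset k i + k i ≤ offset k j := by
  rw [← offset_succ]; exact offset_mono k h

theorem exists_block (k : ℕ → ℕ) {p : ℕ} : ∀ {m : ℕ}, p < offset k m →
    ∃ i < m, ∃ j < k i, p = offset k i + j
  | 0, h => by simp [offset] at h
  | m + 1, h => by
    by_cases h' : p < offset k m
    · obtain ⟨i, hi, h⟩ := exists_block k h'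
      exact ⟨i, by omega, h⟩
    · rw [offset_succ] at h
      exact ⟨m, by omega, p - offset k m, by omega, by omega⟩

theorem block_unique (k : ℕ → ℕ) {i i' j j' : ℕ} (hj : j < k i) (hj' : j' < k i')
    (h : offset k i + j = offset k i' + j') : i = i' := by
  rcases lt_trichotomy i i' with hi | hi | hi
  · have := offset_add_le k hi
    omega
  · exact hi
  · have := offset_add_le k hi
    omega

theorem sum_range_offset (k : ℕ → ℕ) (F : ℕ → ℤ) (m : ℕ) :
    ∑ p ∈ Finset.range (offset k m), F p =
      ∑ i ∈ Finset.range m, ∑ j ∈ Finset.range (k i), F (offset k i + j) := by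
  induction m with
  | zero => simp [offset]
  | succ m ih => rw [offset_succ, Finset.sum_range_add, ih, Finset.sum_range_succ]

/-- The total length of the blocks that `v` places before the block `i`. -/
def before {m : ℕ} {ι : Type*} [LinearOrder ι] (k : ℕ → ℕ) (v : Fin m → ι) (i : Fin m) : ℕ :=
  ∑ j with v j < v i, k j

theorem before_add_le {m : ℕ} {ι : Type*} [LinearOrder ι] (k : ℕ → ℕ) {v : Fin m → ι}
    {i j : Fin m} (h : v i < v j) : before k v i + k i ≤ before k v j := by
  rw [before, before, add_comm, ← Finset.sum_insert (f := fun j : Fin m => k j) (by simp)]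
  refine Finset.sum_le_sum_of_subset fun x hx => ?_
  simp only [Finset.mem_insert, Finset.mem_filter, Finset.mem_univ, true_and] at *
  rcases hx with rfl | hx
  · exact h
  · exact hx.trans h

theorem before_add_le_offset {m : ℕ} {ι : Type*} [LinearOrder ι] (k : ℕ → ℕ) (v : Fin m → ι)
    (i : Fin m) : before k v i + k i ≤ offset k m := by
  rw [before, offset, Finset.sum_range, add_comm,
    ← Finset.sum_insert (f := fun j : Fin m => k j) (by simp)]
  exact Finset.sum_le_sum_of_subset (Finset.subset_univ _)

section blocks

variable {m n : ℕ} {k : ℕ → ℕ} {g : ℕ → ℕ → ℕ}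

/-- Inflation of `ρ`: block `i` takes the interval of values just above those of the blocks that `ρ`
places below it. -/
theorem exists_inflation (hn : offset k m = n) (hlt : ∀ i < m, ∀ j < k i, g i j < k i)
    (hinj : ∀ i < m, ∀ j < k i, ∀ j' < k i, g i j = g i j' → j = j') (ρ : Equiv.Perm (Fin m)) :
    ∃ π : Equiv.Perm (Fin n), ∀ i : Fin m, ∀ j < k i,
      word π (offset k i + j) = (before k ρ i : ℤ) + g i j := by
  subst hn
  have hb : ∀ p : Fin (offset k m), ∃ i : Fin m, ∃ j < k i, (p : ℕ) = offset k i + j := fun p => by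
    obtain ⟨i, hi, h⟩ := exists_block k p.isLt
    exact ⟨⟨i, hi⟩, h⟩
  choose b c hc hp using hb
  have hF : ∀ p, before k ρ (b p) + g (b p) (c p) < offset k m := fun p => by
    have h1 := before_add_le_offset k ρ (b p)
    have h2 := hlt _ (b p).isLt _ (hc p)
    omega
  have hFinj : Function.Injective fun p =>
      (⟨before k ρ (b p) + g (b p) (c p), hF p⟩ : Fin (offset k m)) := fun p q h => by
    have h := Fin.mk.inj_iff.1 h
    have h1 := hlt _ (b p).isLt _ (hc p)
    have h2 := hlt _ (b q).isLt _ (hc q)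
    have hbq : b p = b q := by
      by_contra hne
      rcases lt_or_gt_of_ne (ρ.injective.ne hne) with hl | hl <;>
        have := before_add_le k hl <;> omega
    have h3 := hp p
    have h4 := hp q
    have h5 := hc p
    rw [hbq] at h h3 h5
    have := hinj _ (b q).isLt _ h5 _ (hc q) (by omega)
    exact Fin.ext (by omega)
  refine ⟨Equiv.ofBijective _ (Finite.injective_iff_bijective.1 hFinj), fun i j hj => ?_⟩
  have hpos : offset k i + j < offset k m := by
    have := offset_add_le k i.isLt
    omega
  rw [word_of_lt _ hpos, Equiv.ofBijective_apply]
  have h1 := hp ⟨_, hpos⟩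
  have hbi : b ⟨_, hpos⟩ = i := Fin.ext (block_unique k (hc _) hj h1.symm)
  have hcj : c ⟨_, hpos⟩ = j := by
    rw [hbi] at h1
    simp only at h1
    omega
  simp only [hbi, hcj]
  push_cast
  rfl

/-- Conversely to inflation, each block occupies an interval of values, these intervals are
disjoint, and `ρ` is their relative order. The order then forces the base values. -/
theorem exists_perm_of_blocks (hn : offset k m = n) (hk : ∀ i < m, 0 < k i)
    (hlt : ∀ i < m, ∀ j < k i, g i j < k i)
    (hinj : ∀ i < m, ∀ j < k i, ∀ j' < k i, g i j = g i j' → j = j') (π : Equiv.Perm (Fin n))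
    (hπ : ∀ i < m, ∃ v : ℤ, ∀ j < k i, word π (offset k i + j) = v + g i j) :
    ∃ ρ : Equiv.Perm (Fin m), ∀ i : Fin m, ∀ j < k i,
      word π (offset k i + j) = (before k ρ i : ℤ) + g i j := by
  choose! v hv using hπ
  have hsurj : ∀ i < m, ∀ x < k i, ∃ j < k i, g i j = x := fun i hi x hx => by
    have := Finset.surj_on_of_inj_on_of_card_le (s := Finset.range (k i))
      (t := Finset.range (k i)) (fun j _ => g i j)
      (fun j hj => by simpa using hlt i hi j (by simpa using hj))
      (fun j j' hj hj' h => hinj i hi j (by simpa using hj) j' (by simpa using hj') h)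
      le_rfl x (by simpa using hx)
    obtain ⟨j, hj, h⟩ := this
    exact ⟨j, by simpa using hj, h.symm⟩
  have hpos : ∀ i < m, ∀ j < k i, offset k i + j < n := fun i hi j hj => by
    have := offset_add_le k hi
    omega
  -- If the least letter of block `i'` lay in the interval of block `i`, it would occur in both
  -- blocks.
  have hsep : ∀ i < m, ∀ i' < m, v i ≤ v i' → v i' < v i + k i → i = i' := by
    intro i hi i' hi' h1 h2
    obtain ⟨j, hj, hgj⟩ := hsurj i hi (v i' - v i).toNat (by omega)
    obtain ⟨j', hj', hgj'⟩ := hsurj i' hi' 0 (hk i' hi')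
    refine block_unique k hj hj' (word_inj π (hpos i hi j hj) (hpos i' hi' j' hj') ?_)
    rw [hv i hi j hj, hv i' hi' j' hj', hgj, hgj']
    omega
  have hvinj : Function.Injective fun i : Fin m => v i := fun i i' h => Fin.ext
    (hsep i i.isLt i' i'.isLt h.le (by have := hk i i.isLt; simp only at h; omega))
  obtain ⟨ρ, hρ⟩ := exists_perm_lt_iff hvinj
  refine ⟨ρ, fun i j hj => ?_⟩
  rw [hv i i.isLt j hj]
  congr 1
  obtain ⟨j₀, hj₀, hg₀⟩ := hsurj i i.isLt 0 (hk i i.isLt)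
  have hvi := hv i i.isLt j₀ hj₀
  rw [hg₀, Nat.cast_zero, add_zero] at hvi
  -- Exactly `v i` letters are smaller than `v i`. Counted block by block, each other block
  -- contributes all of its letters or none, which gives `before k ρ i`.
  have hcount := sum_word_lt π (c := v i) (by rw [← hvi]; exact word_nonneg _ _)
    (by rw [← hvi]; exact word_lt π (hpos i i.isLt j₀ hj₀))
  rw [show Finset.range n = Finset.range (offset k m) by rw [hn], sum_range_offset] at hcount
  rw [← hcount, Finset.sum_range, before, Nat.cast_sum, Finset.sum_filter]
  refine Finset.sum_congr rfl fun i' _ => ?_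
  rw [if_congr (hρ i' i) rfl rfl]
  split_ifs with h
  · rw [Finset.sum_congr rfl fun j hj => if_pos ?_]
    · simp
    · rw [Finset.mem_range] at hj
      have h1 := hlt i' i'.isLt j hj
      have h2 : ¬ v i < v i' + k i' := fun h' => by
        have := hsep i' i'.isLt i i.isLt h.le h'
        rw [this] at h
        exact lt_irrefl _ h
      rw [hv i' i'.isLt j hj]
      omega
  · refine Finset.sum_eq_zero fun j hj => if_neg ?_
    rw [Finset.mem_range] at hj
    rw [hv i' i'.isLt j hj]
    omega

/-- The number of permutations of which the consecutive blocks are, up to translation, the given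
permutations of intervals is the factorial of the number of blocks. -/
theorem card_blocks (hn : offset k m = n) (hk : ∀ i < m, 0 < k i)
    (hlt : ∀ i < m, ∀ j < k i, g i j < k i)
    (hinj : ∀ i < m, ∀ j < k i, ∀ j' < k i, g i j = g i j' → j = j') :
    Nat.card {π : Equiv.Perm (Fin n) //
      ∀ i < m, ∃ v : ℤ, ∀ j < k i, word π (offset k i + j) = v + g i j} = m ! := by
  choose Ψ hΨ using exists_inflation hn hlt hinj
  have hmem : ∀ ρ, ∀ i < m, ∃ v : ℤ, ∀ j < k i, word (Ψ ρ) (offset k i + j) = v + g i j :=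
    fun ρ i hi => ⟨_, hΨ ρ ⟨i, hi⟩⟩
  have hcard : Nat.card (Equiv.Perm (Fin m)) = m ! := by
    rw [Nat.card_eq_fintype_card, Fintype.card_perm, Fintype.card_fin]
  rw [← hcard]
  refine (Nat.card_congr (Equiv.ofBijective (fun ρ => ⟨Ψ ρ, hmem ρ⟩) ⟨?_, ?_⟩)).symm
  · intro ρ ρ' h
    have h : Ψ ρ = Ψ ρ' := Subtype.mk.inj h
    have hb : ∀ i, before k ρ i = before k ρ' i := fun i => by
      have h1 := hΨ ρ i 0 (hk i i.isLt)
      rw [h, hΨ ρ' i 0 (hk i i.isLt)] at h1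
      omega
    -- Blocks are nonempty, so their base values recover the order in which the permutation places
    -- them.
    have hiff : ∀ (σ : Equiv.Perm (Fin m)) (i j : Fin m),
        σ i < σ j ↔ before k σ i < before k σ j := fun σ i j => by
      refine ⟨fun h => ?_, fun h => ?_⟩
      · have h1 := before_add_le k h
        have h2 := hk i i.isLt
        omega
      · by_contra hn
        rcases (not_lt.1 hn).lt_or_eq with h' | h'
        · have := before_add_le k h'
          omega
        · rw [σ.injective h'] at h
          omega
    ext i
    rw [← card_filter_perm_lt ρ (ρ i), ← card_filter_perm_lt ρ' (ρ' i)]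
    congr 1
    ext j
    simp only [Finset.mem_filter, Finset.mem_univ, true_and]
    rw [hiff ρ, hiff ρ', hb, hb]
  · rintro ⟨π, hπ⟩
    obtain ⟨ρ, hρ⟩ := exists_perm_of_blocks hn hk hlt hinj π hπ
    refine ⟨ρ, Subtype.ext (word_injective (funext fun p => ?_))⟩
    by_cases hp : p < n
    · obtain ⟨i, hi, j, hj, rfl⟩ := exists_block k (hn ▸ hp)
      rw [hΨ ρ ⟨i, hi⟩ j hj, hρ ⟨i, hi⟩ j hj]
    · rw [word_of_le _ (by omega), word_of_le _ (by omega)]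

end blocks

/-! ### Signed sums over clusters -/

/-- The signed number of sets of occurrences of forbidden patterns that cover the chain with `k`
letters that starts with the given pattern. -/
def clusterWeight : Pattern → ℕ → ℤ
  | .t132, k => if k < 3 then 0 else if k % 3 = 0 then -1 else if k % 3 = 1 then 1 else 0
  | .t213, k => if k < 3 then 0 else if k % 3 = 0 then -1 else if k % 3 = 2 then 1 else 0
  | .t321, k => if k < 3 then 0 else if k % 3 = 0 then -1 else if k % 3 = 1 then 1 else 0
  | .t2341, k => if k < 4 then 0 else if k % 3 = 0 then 1 else if k % 3 = 1 then -1 else 0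

theorem clusterWeight_of_lt (r : Pattern) {k : ℕ} (h : k < r.size) : clusterWeight r k = 0 := by
  cases r <;> simp only [Pattern.size] at h <;> simp only [clusterWeight] <;> exact if_pos h

/-- The first marked pattern is either the whole cluster, with sign -1, or is followed by a marked
pattern overlapping it; deleting the first then flips the sign and shortens the chain by the shift.
The next three lemmas are the same for the other patterns. Truncated subtraction is harmless because
weights of short chains vanish. -/
theorem clusterWeight_t132 (k : ℕ) :
    clusterWeight .t132 k = -(if k = 3 then 1 else 0) - clusterWeight .t213 (k - 1) := by
  simp only [clusterWeight]
  split_ifs <;> omega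

theorem clusterWeight_t213 (k : ℕ) :
    clusterWeight .t213 k = -(if k = 3 then 1 else 0) - clusterWeight .t132 (k - 2) := by
  simp only [clusterWeight]
  split_ifs <;> omega

theorem clusterWeight_t321 (k : ℕ) :
    clusterWeight .t321 k =
      -(if k = 3 then 1 else 0) - clusterWeight .t321 (k - 1) - clusterWeight .t321 (k - 2) := by
  simp only [clusterWeight]
  split_ifs <;> omega

theorem clusterWeight_t2341 (k : ℕ) :
    clusterWeight .t2341 k = -(if k = 4 then 1 else 0) - clusterWeight .t321 (k - 3) := by
  simp only [clusterWeight]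
  split_ifs <;> omega

open Classical in
/-- The indicator of the absence of occurrences of forbidden patterns from position `p` on. -/
noncomputable def free (n : ℕ) (f : ℕ → ℤ) (p : ℕ) : ℤ :=
  if ∃ r, ∃ d ≥ p, Occ n r f d then 0 else 1

theorem free_of_le {n : ℕ} {f : ℕ → ℤ} {p : ℕ} (h : n ≤ p) : free n f p = 1 := by
  refine if_neg ?_
  rintro ⟨r, d, hd, ho⟩
  have := r.size_pos
  have := ho.1
  omega

theorem free_of_occ {n : ℕ} {f : ℕ → ℤ} {p : ℕ} {r : Pattern} (h : Occ n r f p) :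
    free n f p = 0 := if_pos ⟨r, p, le_rfl, h⟩

theorem free_of_forall_not {n : ℕ} {f : ℕ → ℤ} {p : ℕ} (h : ∀ r, ¬ Occ n r f p) :
    free n f p = free n f (p + 1) := by
  unfold free
  congr 1
  refine propext (exists_congr fun r => ⟨?_, ?_⟩)
  · rintro ⟨d, hd, ho⟩
    refine ⟨d, lt_of_le_of_ne hd ?_, ho⟩
    rintro rfl
    exact h r ho
  · rintro ⟨d, hd, ho⟩
    exact ⟨d, by omega, ho⟩

open Classical in
theorem free_of_forall_eq {n : ℕ} {f : ℕ → ℤ} {p : ℕ} {s : Pattern}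
    (h : ∀ r, Occ n r f p → r = s) :
    free n f p = if Occ n s f p then 0 else free n f (p + 1) := by
  split_ifs with hs
  · exact free_of_occ hs
  · refine free_of_forall_not fun r hr => hs ?_
    rw [← h r hr]
    exact hr

open Classical in
/-- The sum over the chains that start with the pattern `r` at the position `p`. -/
noncomputable def clusterSum (n : ℕ) (f : ℕ → ℤ) (w : ℕ → ℤ) (r : Pattern) (p N : ℕ) : ℤ :=
  ∑ k ∈ Finset.range N, if HasShape n r.shape k f p then w k * free n f (p + k) else 0

theorem hasShape_add_iff {n : ℕ} {f : ℕ → ℤ} {p e k : ℕ} {r s : Pattern} (hr : Occ n r f p)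
    (he : e < r.size) (_hk : r.size ≤ e + k)
    (h : ∀ i, r.shape (e + i) = r.shape e + s.shape i) :
    HasShape n r.shape (e + k) f p ↔ HasShape n s.shape k f (p + e) := by
  constructor
  · rintro ⟨hn, hs⟩
    refine ⟨by omega, fun i hi => ?_⟩
    rw [add_assoc, hs _ (by omega), hs e (by omega), h, add_assoc]
  · intro hs
    exact ⟨by have := hs.1; omega, HasShape.append hr hs he (fun _ _ => rfl) fun i _ => h i⟩

/-- Once `r` occurs at `p`, extending its chain through `s` at distance `e` is the same as having a
chain of `s` at `p + e`. Lengths too short to contain `s` have weight zero. -/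
theorem clusterSum_shift {n : ℕ} {f : ℕ → ℤ} {p e N : ℕ} {r s : Pattern} (hr : Occ n r f p)
    (he : e < r.size) (he' : r.size ≤ e + 3)
    (h : ∀ i, r.shape (e + i) = r.shape e + s.shape i) :
    clusterSum n f (fun k => clusterWeight s (k - e)) r p (e + N) =
      clusterSum n f (clusterWeight s) s (p + e) N := by
  rw [clusterSum, clusterSum, Finset.sum_range_add, Finset.sum_eq_zero, zero_add]
  · refine Finset.sum_congr rfl fun k _ => ?_
    rw [Nat.add_sub_cancel_left, ← add_assoc]
    by_cases hk : k < s.size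
    · simp [clusterWeight_of_lt s hk]
    · have := s.three_le_size
      have hiff := hasShape_add_iff (k := k) hr he (by omega) h
      by_cases hs : HasShape n s.shape k f (p + e)
      · rw [if_pos hs, if_pos (hiff.2 hs)]
      · rw [if_neg hs, if_neg fun h' => hs (hiff.1 h')]
  · intro k hk
    rw [Finset.mem_range] at hk
    rw [clusterWeight_of_lt s (by have := s.size_pos; omega)]
    simp

theorem clusterSum_single {n : ℕ} {f : ℕ → ℤ} {p N : ℕ} {r : Pattern} (hr : Occ n r f p)
    (hN : r.size < N) :
    clusterSum n f (fun k => if k = r.size then 1 else 0) r p N = free n f (p + r.size) := by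
  rw [clusterSum, Finset.sum_eq_single r.size, if_pos (show HasShape n r.shape r.size f p from hr),
    if_pos rfl, one_mul]
  · intro k _ hk
    simp [hk]
  · intro h
    simp only [Finset.mem_range] at h
    omega

theorem clusterSum_sub (n : ℕ) (f : ℕ → ℤ) (w w' : ℕ → ℤ) (r : Pattern) (p N : ℕ) :
    clusterSum n f (fun k => w k - w' k) r p N =
      clusterSum n f w r p N - clusterSum n f w' r p N := by
  simp only [clusterSum, ← Finset.sum_sub_distrib]
  refine Finset.sum_congr rfl fun k _ => ?_
  split_ifs <;> ring

theorem clusterSum_neg (n : ℕ) (f : ℕ → ℤ) (w : ℕ → ℤ) (r : Pattern) (p N : ℕ) :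
    clusterSum n f (fun k => - w k) r p N = - clusterSum n f w r p N := by
  simp only [clusterSum, ← Finset.sum_neg_distrib]
  refine Finset.sum_congr rfl fun k _ => ?_
  split_ifs <;> ring

theorem clusterSum_of_not_occ {n : ℕ} {f : ℕ → ℤ} {p : ℕ} {r : Pattern} (N : ℕ)
    (h : ¬ Occ n r f p) : clusterSum n f (clusterWeight r) r p N = 0 := by
  refine Finset.sum_eq_zero fun k _ => ?_
  split_ifs with hk
  · rw [clusterWeight_of_lt r, zero_mul]
    by_contra hs
    exact h ⟨by have := hk.1; omega, fun i hi => hk.2 i (by omega)⟩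
  · rfl

theorem shape_t132_add (i : ℕ) :
    Pattern.shape .t132 (1 + i) = Pattern.shape .t132 1 + Pattern.shape .t213 i := by
  simp only [Pattern.shape]
  split_ifs <;> omega

theorem shape_t213_add (i : ℕ) :
    Pattern.shape .t213 (2 + i) = Pattern.shape .t213 2 + Pattern.shape .t132 i := by
  simp only [Pattern.shape]
  split_ifs <;> omega

theorem shape_t321_add (e i : ℕ) :
    Pattern.shape .t321 (e + i) = Pattern.shape .t321 e + Pattern.shape .t321 i := by
  simp only [Pattern.shape]
  omega

theorem shape_t2341_add (i : ℕ) :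
    Pattern.shape .t2341 (3 + i) = Pattern.shape .t2341 3 + Pattern.shape .t321 i := by
  simp only [Pattern.shape]
  split_ifs <;> omega

-- The recursion for the weights matches the one for `free`: with `r` at `p`, each position from `p
-- + 1` to the end of `r` can start only the patterns allowed by `overlap_cases`, and `free` is
-- expanded across these positions.
open Classical in
theorem clusterSum_eq {n : ℕ} {f : ℕ → ℤ} (hf : Distinct n f) (N : ℕ) :
    ∀ (r : Pattern) (p : ℕ), n < p + N → clusterSum n f (clusterWeight r) r p N =
      if Occ n r f p then - free n f (p + 1) else 0 := by
  induction N using Nat.strong_induction_on with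
  | _ N ih =>
  intro r p hN
  by_cases ho : Occ n r f p
  swap
  · rw [if_neg ho, clusterSum_of_not_occ N ho]
  rw [if_pos ho]
  have hn := ho.1
  have next : ∀ (s : Pattern) (e : ℕ), 0 < e → e < r.size → r.size ≤ e + 3 →
      (∀ i, r.shape (e + i) = r.shape e + s.shape i) →
      clusterSum n f (fun k => clusterWeight s (k - e)) r p N =
        if Occ n s f (p + e) then - free n f (p + e + 1) else 0 := by
    intro s e h0 he he' h
    obtain ⟨N, rfl⟩ := Nat.exists_eq_add_of_le (show e ≤ N by omega)
    rw [clusterSum_shift ho he he' h]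
    -- The shift `e > 0` has been subtracted from the length bound, so the induction hypothesis
    -- applies.
    exact ih N (by omega) s (p + e) (by omega)
  cases r with
  | t132 =>
    have single : clusterSum n f (fun k => if k = 3 then 1 else 0) .t132 p N = free n f (p + 3) :=
      clusterSum_single ho (by simp only [Pattern.size] at hn ⊢; omega)
    have h1 := free_of_forall_eq (p := p + 1) (s := .t213) fun s hs => by
      simpa using overlap_cases hf ho hs (by decide)
    have h2 := free_of_forall_not (p := p + 2) fun s hs => by
      simpa using overlap_cases hf ho hs (by decide)
    rw [funext clusterWeight_t132, clusterSum_sub, clusterSum_neg,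
      next .t213 1 (by decide) (by decide) (by decide) shape_t132_add]
    simp only [add_assoc, Nat.reduceAdd] at h1 h2 ⊢
    rw [single]
    split_ifs at h1 ⊢ <;> omega
  | t213 =>
    have single : clusterSum n f (fun k => if k = 3 then 1 else 0) .t213 p N = free n f (p + 3) :=
      clusterSum_single ho (by simp only [Pattern.size] at hn ⊢; omega)
    have h1 := free_of_forall_not (p := p + 1) fun s hs => by
      simpa using overlap_cases hf ho hs (by decide)
    have h2 := free_of_forall_eq (p := p + 2) (s := .t132) fun s hs => by
      simpa using overlap_cases hf ho hs (by decide)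
    rw [funext clusterWeight_t213, clusterSum_sub, clusterSum_neg,
      next .t132 2 (by decide) (by decide) (by decide) shape_t213_add]
    simp only [add_assoc, Nat.reduceAdd] at h1 h2 ⊢
    rw [single]
    split_ifs at h2 ⊢ <;> omega
  | t321 =>
    have single : clusterSum n f (fun k => if k = 3 then 1 else 0) .t321 p N = free n f (p + 3) :=
      clusterSum_single ho (by simp only [Pattern.size] at hn ⊢; omega)
    have h1 := free_of_forall_eq (p := p + 1) (s := .t321) fun s hs => by
      simpa using overlap_cases hf ho hs (by decide)
    have h2 := free_of_forall_eq (p := p + 2) (s := .t321) fun s hs => by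
      simpa using overlap_cases hf ho hs (by decide)
    rw [funext clusterWeight_t321, clusterSum_sub, clusterSum_sub, clusterSum_neg,
      next .t321 1 (by decide) (by decide) (by decide) (shape_t321_add 1),
      next .t321 2 (by decide) (by decide) (by decide) (shape_t321_add 2)]
    simp only [add_assoc, Nat.reduceAdd] at h1 h2 ⊢
    rw [single]
    split_ifs at h1 h2 ⊢ <;> omega
  | t2341 =>
    have single : clusterSum n f (fun k => if k = 4 then 1 else 0) .t2341 p N = free n f (p + 4) :=
      clusterSum_single ho (by simp only [Pattern.size] at hn ⊢; omega)
    have h1 := free_of_forall_not (p := p + 1) fun s hs => by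
      simpa using overlap_cases hf ho hs (by decide)
    have h2 := free_of_forall_not (p := p + 2) fun s hs => by
      simpa using overlap_cases hf ho hs (by decide)
    have h3 := free_of_forall_eq (p := p + 3) (s := .t321) fun s hs => by
      simpa using overlap_cases hf ho hs (by decide)
    rw [funext clusterWeight_t2341, clusterSum_sub, clusterSum_neg,
      next .t321 3 (by decide) (by decide) (by decide) shape_t2341_add]
    simp only [add_assoc, Nat.reduceAdd] at h1 h2 h3 ⊢
    rw [single]
    split_ifs at h3 ⊢ <;> omega

/-! ### Blocks -/

/-- The relative letters of a block: a single letter or a chain of patterns. -/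
def blockShape : Option Pattern → ℕ → ℤ
  | none, _ => 0
  | some r, i => r.shape i

/-- The weight of a block with `k` letters. -/
def blockWeight : Option Pattern → ℕ → ℤ
  | none, k => if k = 1 then 1 else 0
  | some r, k => clusterWeight r k

-- The single letter contributes `free n f (p + 1)`. A pattern at `p`, necessarily unique,
-- contributes the same with a minus sign through its chains, so the sum vanishes exactly when it
-- must.
open Classical in
theorem free_eq_sum_blocks {n : ℕ} {f : ℕ → ℤ} (hf : Distinct n f) {p N : ℕ} (hp : p < n)
    (hN : n < p + N) :
    free n f p = ∑ t, ∑ k ∈ Finset.range N,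
      if HasShape n (blockShape t) k f p then blockWeight t k * free n f (p + k) else 0 := by
  have hnone : ∑ k ∈ Finset.range N, (if HasShape n (blockShape none) k f p then
      blockWeight none k * free n f (p + k) else 0) = free n f (p + 1) := by
    rw [Finset.sum_eq_single 1]
    · rw [if_pos ⟨by omega, fun i hi => by
        rw [Nat.lt_one_iff.1 hi]; simp [blockShape]⟩]
      simp [blockWeight]
    · intro k _ hk
      simp [blockWeight, hk]
    · intro h
      simp only [Finset.mem_range] at h
      omega
  have hsome : ∀ r : Pattern, ∑ k ∈ Finset.range N, (if HasShape n (blockShape (some r)) k f p then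
      blockWeight (some r) k * free n f (p + k) else 0) =
      if Occ n r f p then - free n f (p + 1) else 0 := fun r => clusterSum_eq hf N r p hN
  rw [Fintype.sum_option, hnone, Finset.sum_congr rfl fun r _ => hsome r]
  by_cases ho : ∃ r, Occ n r f p
  · obtain ⟨r, hr⟩ := ho
    rw [Finset.sum_eq_single r, if_pos hr, free_of_occ hr]
    · ring
    · intro s _ hs
      refine if_neg fun h => hs ?_
      simpa [eq_comm] using overlap_cases hf hr (e := 0) h r.size_pos
    · simp
  · rw [Finset.sum_eq_zero, add_zero, free_of_forall_not]
    · exact fun r hr => ho ⟨r, hr⟩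
    · exact fun r _ => if_neg fun hr => ho ⟨r, hr⟩

theorem length_pos_of_blockWeight_ne_zero {t : Option Pattern} {k : ℕ} (h : blockWeight t k ≠ 0) :
    0 < k := by
  rw [Nat.pos_iff_ne_zero]
  rintro rfl
  rcases t with _ | _ | _ | _ | _ <;> exact h rfl

/-- The least relative letter of a block. -/
def blockMin : Option Pattern → ℕ → ℤ
  | none, _ => 0
  | some .t132, _ => 0
  | some .t213, _ => -1
  | some .t321, k => 1 - k
  | some .t2341, k => 3 - k

/-- Together with `blockShape_inj`: the letters of a block fill an interval. Nonzero weight is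
essential, since a 213-chain cut after four letters reads 2135. -/
theorem blockShape_mem {t : Option Pattern} {k i : ℕ} (h : blockWeight t k ≠ 0) (hi : i < k) :
    blockMin t k ≤ blockShape t i ∧ blockShape t i < blockMin t k + k := by
  rcases t with _ | _ | _ | _ | _ <;>
    simp only [blockWeight, clusterWeight, blockMin, blockShape, Pattern.shape] at * <;>
    split_ifs at * <;> omega

theorem blockShape_inj {t : Option Pattern} {k i j : ℕ} (h : blockWeight t k ≠ 0) (hi : i < k)
    (hj : j < k) (hij : blockShape t i = blockShape t j) : i = j := by
  rcases t with _ | _ | _ | _ | _ <;>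
    simp only [blockWeight, clusterWeight, blockShape, Pattern.shape] at * <;>
    split_ifs at * <;> omega

/-! ### Summation over all decompositions into blocks -/

/-- The word `f` of length `n` starts with the first `m` of the blocks `ℓ`. -/
def Fits (n : ℕ) (ℓ : ℕ → Option Pattern × ℕ) (m : ℕ) (f : ℕ → ℤ) : Prop :=
  ∀ i < m, HasShape n (blockShape (ℓ i).1) (ℓ i).2 f (offset (fun j => (ℓ j).2) i)

theorem blockShape_zero (t : Option Pattern) : blockShape t 0 = 0 := by
  cases t <;> simp [blockShape]

theorem card_fits {n m : ℕ} {ℓ : ℕ → Option Pattern × ℕ}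
    (hℓ : ∀ i < m, blockWeight (ℓ i).1 (ℓ i).2 ≠ 0) (hn : offset (fun j => (ℓ j).2) m = n) :
    Nat.card {π : Equiv.Perm (Fin n) // Fits n ℓ m (word π)} = m ! := by
  have hmem := fun i hi j hj => blockShape_mem (hℓ i hi) (i := j) hj
  rw [← card_blocks (k := fun j => (ℓ j).2)
    (g := fun i j => (blockShape (ℓ i).1 j - blockMin (ℓ i).1 (ℓ i).2).toNat) hn
    (fun i hi => length_pos_of_blockWeight_ne_zero (hℓ i hi))
    (fun i hi j hj => by have := hmem i hi j hj; omega)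
    (fun i hi j hj j' hj' h => blockShape_inj (hℓ i hi) hj hj' (by
      have h1 := hmem i hi j hj
      have h2 := hmem i hi j' hj'
      omega))]
  refine Nat.card_congr (Equiv.subtypeEquivRight fun π =>
    forall_congr' fun i => forall_congr' fun hi => ⟨?_, ?_⟩)
  · rintro ⟨-, h⟩
    refine ⟨word π (offset (fun j => (ℓ j).2) i) + blockMin (ℓ i).1 (ℓ i).2, fun j hj => ?_⟩
    have := hmem i hi j hj
    rw [h j hj]
    omega
  · rintro ⟨v, hv⟩
    refine ⟨hn ▸ offset_add_le _ hi, fun j hj => ?_⟩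
    have h1 := hmem i hi j hj
    have h2 := hmem i hi 0 (by omega)
    have h3 := hv 0 (by omega)
    rw [blockShape_zero] at h2 h3
    rw [add_zero] at h3
    rw [hv j hj, h3]
    omega

theorem offset_update (ℓ : ℕ → Option Pattern × ℕ) (x : Option Pattern × ℕ) {m i : ℕ}
    (hi : i ≤ m) :
    offset (fun j => (Function.update ℓ m x j).2) i = offset (fun j => (ℓ j).2) i := by
  refine Finset.sum_congr rfl fun j hj => ?_
  rw [Finset.mem_range] at hj
  change (Function.update ℓ m x j).2 = (ℓ j).2
  rw [Function.update_of_ne (by omega)]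

theorem fits_update {n m : ℕ} (ℓ : ℕ → Option Pattern × ℕ) (t : Option Pattern) (k : ℕ)
    (f : ℕ → ℤ) : Fits n (Function.update ℓ m (t, k)) (m + 1) f ↔
      Fits n ℓ m f ∧ HasShape n (blockShape t) k f (offset (fun j => (ℓ j).2) m) := by
  have hlt : ∀ i < m, Function.update ℓ m (t, k) i = ℓ i := fun i hi =>
    Function.update_of_ne (by omega) _ _
  constructor
  · intro h
    refine ⟨fun i hi => ?_, ?_⟩
    · have := h i (by omega)
      rwa [offset_update _ _ hi.le, hlt i hi] at this
    · have := h m (by omega)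
      rwa [offset_update _ _ le_rfl, Function.update_self] at this
  · rintro ⟨h, h'⟩ i hi
    rcases Nat.lt_succ_iff_lt_or_eq.1 hi with hi | rfl
    · rw [offset_update _ _ hi.le, hlt i hi]
      exact h i hi
    · rw [offset_update _ _ le_rfl, Function.update_self]
      exact h'

/-- The generating function of the blocks. -/
noncomputable def blockSeries : ℤ⟦X⟧ := PowerSeries.mk fun k => ∑ t, blockWeight t k

theorem constantCoeff_blockSeries : PowerSeries.constantCoeff blockSeries = 0 := by
  rw [← PowerSeries.coeff_zero_eq_constantCoeff_apply, blockSeries, PowerSeries.coeff_mk]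
  rfl

-- Induction on the room left to the right of the `m` blocks already placed: appending a block
-- multiplies by `blockSeries` and raises `m` by one. When the word is full, `card_fits` supplies
-- the factorial.
open Classical in
theorem sum_free_of_fits {n : ℕ} (N : ℕ) : ∀ (m : ℕ) (ℓ : ℕ → Option Pattern × ℕ),
    (∀ i < m, blockWeight (ℓ i).1 (ℓ i).2 ≠ 0) → offset (fun j => (ℓ j).2) m ≤ n →
    n < offset (fun j => (ℓ j).2) m + N →
    ∑ π : Equiv.Perm (Fin n), (if Fits n ℓ m (word π) then
        free n (word π) (offset (fun j => (ℓ j).2) m) else 0) =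
      ∑ j ∈ Finset.range N, ((m + j)! : ℤ) *
        PowerSeries.coeff (n - offset (fun j => (ℓ j).2) m) (blockSeries ^ j) := by
  induction N with
  | zero => intro m ℓ _ h1 h2; omega
  | succ N ih =>
  intro m ℓ hℓ hle hlt
  -- If the blocks already fill the word, only `j = 0` survives, since `blockSeries` has no constant
  -- term.
  rcases hle.eq_or_lt with heq | hpn
  · have hzero : ∀ j ∈ Finset.range N, ((m + (j + 1))! : ℤ) *
        PowerSeries.coeff 0 (blockSeries ^ (j + 1)) = 0 := fun j _ => by
      rw [PowerSeries.coeff_zero_eq_constantCoeff_apply, map_pow, constantCoeff_blockSeries,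
        pow_succ, mul_zero, mul_zero]
    rw [heq, Nat.sub_self, Finset.sum_range_succ', Finset.sum_eq_zero hzero, zero_add,
      Finset.sum_congr rfl fun π _ => by rw [free_of_le le_rfl], Finset.sum_boole, add_zero,
      pow_zero, PowerSeries.coeff_zero_one, mul_one, ← card_fits hℓ heq,
      Nat.card_eq_fintype_card, Fintype.card_subtype]
  set p := offset (fun j => (ℓ j).2) m with hp
  have hsplit : ∀ π : Equiv.Perm (Fin n), (if Fits n ℓ m (word π) then free n (word π) p else 0) =
      ∑ t, ∑ k ∈ Finset.range (n - p + 1), blockWeight t k *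
        (if Fits n (Function.update ℓ m (t, k)) (m + 1) (word π) then
          free n (word π) (p + k) else 0) := by
    intro π
    by_cases hfit : Fits n ℓ m (word π)
    · rw [if_pos hfit, free_eq_sum_blocks (distinct_word π) hpn (N := n - p + 1) (by omega)]
      refine Finset.sum_congr rfl fun t _ => Finset.sum_congr rfl fun k _ => ?_
      by_cases hs : HasShape n (blockShape t) k (word π) p
      · rw [if_pos hs, if_pos ((fits_update ℓ t k _).2 ⟨hfit, hs⟩)]
      · rw [if_neg hs, if_neg fun h => hs ((fits_update ℓ t k _).1 h).2, mul_zero]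
    · rw [if_neg hfit]
      refine (Finset.sum_eq_zero fun t _ => Finset.sum_eq_zero fun k _ => ?_).symm
      rw [if_neg fun h => hfit ((fits_update ℓ t k _).1 h).1, mul_zero]
  have hblock : ∀ t, ∀ k ∈ Finset.range (n - p + 1), ∑ π : Equiv.Perm (Fin n), blockWeight t k *
        (if Fits n (Function.update ℓ m (t, k)) (m + 1) (word π) then
          free n (word π) (p + k) else 0) =
      ∑ j ∈ Finset.range N, ((m + (j + 1))! : ℤ) *
        (blockWeight t k * PowerSeries.coeff (n - p - k) (blockSeries ^ j)) := by
    intro t k hk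
    rw [Finset.mem_range] at hk
    by_cases hw : blockWeight t k = 0
    · simp [hw]
    have hk0 := length_pos_of_blockWeight_ne_zero hw
    have hoff : offset (fun j => (Function.update ℓ m (t, k) j).2) (m + 1) = p + k := by
      rw [offset_succ, offset_update _ _ le_rfl, Function.update_self]
    have := ih (m + 1) (Function.update ℓ m (t, k)) (fun i hi => by
      rcases Nat.lt_succ_iff_lt_or_eq.1 hi with hi | rfl
      · rw [Function.update_of_ne (by omega)]
        exact hℓ i hi
      · rwa [Function.update_self]) (by omega) (by omega)
    rw [hoff] at this
    rw [← Finset.mul_sum, this, Finset.mul_sum]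
    refine Finset.sum_congr rfl fun j _ => ?_
    rw [add_assoc, add_comm 1 j, Nat.sub_add_eq]
    ring
  rw [Finset.sum_congr rfl fun π _ => hsplit π, Finset.sum_comm,
    Finset.sum_congr rfl fun t _ => Finset.sum_comm,
    Finset.sum_congr rfl fun t _ => Finset.sum_congr rfl (hblock t), Finset.sum_comm,
    Finset.sum_congr rfl fun k _ => Finset.sum_comm, Finset.sum_comm, Finset.sum_range_succ',
    pow_zero, PowerSeries.coeff_one, if_neg (by omega), mul_zero, add_zero]
  refine Finset.sum_congr rfl fun j _ => ?_
  rw [pow_succ', PowerSeries.coeff_mul, Finset.Nat.sum_antidiagonal_eq_sum_range_succ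
    fun a b => PowerSeries.coeff a blockSeries * PowerSeries.coeff b (blockSeries ^ j),
    Finset.mul_sum]
  refine Finset.sum_congr rfl fun k _ => ?_
  rw [blockSeries, PowerSeries.coeff_mk, ← Finset.mul_sum, Finset.sum_mul]

theorem card_avoiders {n N : ℕ} (hN : n < N) : (Nat.card (avoiders n) : ℤ) =
    ∑ j ∈ Finset.range N, (j ! : ℤ) * PowerSeries.coeff n (blockSeries ^ j) := by
  classical
  have := sum_free_of_fits (n := n) N 0 (fun _ => (none, 0)) (by simp) (by simp [offset])
    (by simpa [offset] using hN)
  simp only [offset, Finset.range_zero, Finset.sum_empty, Nat.sub_zero, zero_add] at this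
  rw [← this, Nat.card_eq_fintype_card, Fintype.card_subtype, Finset.card_filter]
  push_cast
  refine Finset.sum_congr rfl fun π _ => ?_
  have hfits : Fits n (fun _ => (none, 0)) 0 (word π) := fun i hi => by omega
  rw [if_pos hfits, free, mem_avoiders_iff]
  by_cases h : ∃ r, ∃ d ≥ 0, Occ n r (word π) d
  · obtain ⟨r, d, -, ho⟩ := h
    rw [if_neg fun h => h r d ho, if_pos ⟨r, d, by omega, ho⟩]
  · rw [if_neg h, if_pos fun r d ho => h ⟨r, d, by omega, ho⟩]

/-! ### The generating function -/

/-- The weights have period 3 from length 4 on; length 3 is exceptional because no chain starting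
with 2341 is that short. -/
theorem sum_blockWeight (k : ℕ) : ∑ t, blockWeight t k =
    if k < 3 then if k = 1 then 1 else 0 else
      if k = 3 then -3 else if k % 3 = 0 then -2 else 1 := by
  have huniv : (Finset.univ : Finset Pattern) = {.t132, .t213, .t321, .t2341} := rfl
  rw [Fintype.sum_option, huniv, Finset.sum_insert (by decide), Finset.sum_insert (by decide),
    Finset.sum_insert (by decide), Finset.sum_singleton]
  simp only [blockWeight, clusterWeight]
  split_ifs <;> omega

theorem blockSeries_mul : blockSeries * (PowerSeries.X ^ 2 + PowerSeries.X + 1) =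
    -PowerSeries.X ^ 5 - 2 * PowerSeries.X ^ 4 - 2 * PowerSeries.X ^ 3
      + PowerSeries.X ^ 2 + PowerSeries.X := by
  ext n
  rw [mul_add, mul_add, mul_one]
  nth_rewrite 2 [← pow_one (PowerSeries.X : ℤ⟦X⟧)]
  simp only [two_mul, map_add, map_sub, map_neg, PowerSeries.coeff_mul_X_pow',
    PowerSeries.coeff_X_pow, PowerSeries.coeff_X, blockSeries, PowerSeries.coeff_mk]
  rcases lt_or_ge n 6 with hn | hn
  · simp only [sum_blockWeight]
    interval_cases n <;> decide
  -- Past the numerator's degree, the product adds three consecutive periodic weights: 1 + 1 - 2 =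
  -- 0.
  · have hw : ∀ k ≥ 4, ∑ t, blockWeight t k = if k % 3 = 0 then -2 else 1 := fun k hk => by
      rw [sum_blockWeight, if_neg (by omega), if_neg (by omega)]
    rw [if_pos (by omega), if_pos (by omega), if_neg (show n ≠ 5 by omega),
      if_neg (show n ≠ 4 by omega), if_neg (show n ≠ 3 by omega), if_neg (show n ≠ 2 by omega),
      if_neg (show n ≠ 1 by omega), hw _ (by omega), hw _ (by omega), hw _ (by omega)]
    split_ifs <;> omega

theorem map_blockSeries : PowerSeries.map (Int.castRingHom ℚ) blockSeries = ratio := by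
  rw [ratio, PowerSeries.eq_mul_inv_iff_mul_eq (by simp)]
  have := congrArg (PowerSeries.map (Int.castRingHom ℚ)) blockSeries_mul
  simpa [two_mul] using this

theorem coeff_ratio_pow (n m : ℕ) :
    PowerSeries.coeff n (ratio ^ m) = ((PowerSeries.coeff n (blockSeries ^ m) : ℤ) : ℚ) := by
  rw [← map_blockSeries, ← map_pow, PowerSeries.coeff_map]
  rfl

/-- Makes the formal sum finite in every coefficient, which gives its convergence. -/
theorem coeff_blockSeries_pow_of_lt {n m : ℕ} (h : n < m) :
    PowerSeries.coeff n (blockSeries ^ m) = 0 :=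
  PowerSeries.X_pow_dvd_iff.1 (pow_dvd_pow_of_dvd
    (PowerSeries.X_dvd_iff.2 constantCoeff_blockSeries) m) n h

theorem hasFormalSum_card_avoiders :
    HasFormalSum (fun m : ℕ => (m ! : ℚ⟦X⟧) * ratio ^ m)
      (PowerSeries.mk fun n : ℕ => (Nat.card (avoiders n) : ℚ)) := by
  let _ : TopologicalSpace ℚ := ⊥
  let _ : TopologicalSpace ℚ⟦X⟧ := PowerSeries.WithPiTopology.instTopologicalSpace ℚ
  change HasSum _ _
  rw [PowerSeries.WithPiTopology.hasSum_iff_hasSum_coeff]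
  intro n
  have hcoeff : ∀ m : ℕ, PowerSeries.coeff n ((m ! : ℚ⟦X⟧) * ratio ^ m) =
      (((m ! : ℤ) * PowerSeries.coeff n (blockSeries ^ m) : ℤ) : ℚ) := fun m => by
    rw [← nsmul_eq_mul, map_nsmul, coeff_ratio_pow, nsmul_eq_mul]
    push_cast
    rfl
  have hsum : PowerSeries.coeff n (PowerSeries.mk fun n : ℕ => (Nat.card (avoiders n) : ℚ)) =
      ∑ m ∈ Finset.range (n + 1), PowerSeries.coeff n ((m ! : ℚ⟦X⟧) * ratio ^ m) := by
    rw [PowerSeries.coeff_mk, Finset.sum_congr rfl fun m _ => hcoeff m, ← Int.cast_sum,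
      ← card_avoiders (Nat.lt_succ_self n), Int.cast_natCast]
  rw [hsum]
  refine hasSum_sum_of_ne_finset_zero fun m hm => ?_
  rw [Finset.mem_range] at hm
  rw [hcoeff, coeff_blockSeries_pow_of_lt (by omega), mul_zero, Int.cast_zero]

end Hertzsprung

theorem mainTheorem4 :
    (∀ n : ℕ,
      (∀ π : Equiv.Perm (Fin n),
        ∃! ρ : Equiv.Perm (Fin n), ρ ∈ Hertzsprung.avoiders n ∧ (Hertzsprung.eqvSetoid n) π ρ) ∧
      Nat.card (Quotient (Hertzsprung.eqvSetoid n)) = Nat.card (Hertzsprung.avoiders n)) ∧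
    Hertzsprung.HasFormalSum (fun m : ℕ => (m ! : ℚ⟦X⟧) * Hertzsprung.ratio ^ m)
      (PowerSeries.mk fun n : ℕ => (Nat.card (Quotient (Hertzsprung.eqvSetoid n)) : ℚ)) := by
  refine ⟨fun n => ⟨Hertzsprung.existsUnique_avoider, Hertzsprung.card_quotient_eqvSetoid n⟩, ?_⟩
  simp only [Hertzsprung.card_quotient_eqvSetoid]
  exact Hertzsprung.hasFormalSum_card_avoiders
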